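/- Let $\mathbb{O}$ be the real algebra of octonions, realized as pairs of real quaternions with product $(a,b)(c,d)=(ac-db^*,\,a^*d+cb)$, conjugation $(a,b)^*=(a^*,-b)$ and inner product $\langle x,y\rangle=\mathrm{Re}(x^*y)$. Let $\mathrm{Im}\,\mathbb{O}=\{x : x^*=-x\}$, let $\mathfrak{so}(\mathbb{O})$ and $\mathfrak{so}(\mathrm{Im}\,\mathbb{O})$ be the Lie algebras of skew-adjoint real-linear endomorphisms of $\mathbb{O}$ and of $\mathrm{Im}\,\mathbb{O}$, and let $\mathrm{Der}(\mathbb{O})$ be the Lie algebra of derivations of $\mathbb{O}$. For $a\in\mathrm{Im}\,\mathbb{O}$ let $L_a x=ax$ and $R_a x=xa$ on $\mathbb{O}$, and $\mathrm{ad}_a x=ax-xa$ on $\mathrm{Im}\,\mathbb{O}$. Then: 1. $\mathrm{Der}(\mathbb{O})$ is a compact real form of $\mathfrak{g}_2$: its Killing form is negative definite, and its complexification is isomorphic to the complex simple Lie algebra of type $G_2$ (the one given by the Serre presentation for the Cartan matrix of type $G_2$). 2. There are inclusions of Lie algebras $\mathrm{Der}(\mathbb{O})\subset\mathfrak{so}(\mathrm{Im}\,\mathbb{O})\subset\mathfrak{so}(\mathbb{O})$: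 the first restricts a derivation to $\mathrm{Im}\,\mathbb{O}$, the second extends a map by $0$ on $\mathbb{R}1$, and the composite sends a derivation to itself as a linear map on $\mathbb{O}$. 3. For $a\in\mathrm{Im}\,\mathbb{O}$, the maps $L_a,R_a$ lie in $\mathfrak{so}(\mathbb{O})$ and $\mathrm{ad}_a$ lies in $\mathfrak{so}(\mathrm{Im}\,\mathbb{O})$; the linear maps $a\mapsto L_a$, $a\mapsto R_a$, $a\mapsto \mathrm{ad}_a$ are injective on $\mathrm{Im}\,\mathbb{O}$, and with $L_{\mathrm{Im}\,\mathbb{O}}$, $R_{\mathrm{Im}\,\mathbb{O}}$, $\mathrm{ad}_{\mathrm{Im}\,\mathbb{O}}$ denoting their images, there are direct sum decompositions of vector spaces $$\mathfrak{so}(\mathrm{Im}\,\mathbb{O})=\mathrm{Der}(\mathbb{O})\oplus\mathrm{ad}_{\mathrm{Im}\,\mathbb{O}},\qquad \mathfrak{so}(\mathbb{O})=\mathrm{Der}(\mathbb{O})\oplus L_{\mathrm{Im}\,\mathbb{O}}\oplus R_{\mathrm{Im}\,\mathbb{O}}.$$ 4. The brackets are built from the following bilinear operations on the summands: the commutator of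 derivations, the action of $\mathrm{Der}(\mathbb{O})$ on $\mathrm{Im}\,\mathbb{O}$, the commutator $[a,b]=ab-ba\in\mathrm{Im}\,\mathbb{O}$ and the derivation $D_{a,b}\in\mathrm{Der}(\mathbb{O})$ given by $D_{a,b}x=[[a,b],x]-3\big((ab)x-a(bx)\big)$, for $a,b\in\mathrm{Im}\,\mathbb{O}$. Explicitly, for $D\in\mathrm{Der}(\mathbb{O})$ and $a,b\in\mathrm{Im}\,\mathbb{O}$, the bracket of two derivations is their commutator in $\mathrm{Der}(\mathbb{O})$, and $$[D,\mathrm{ad}_a]=\mathrm{ad}_{Da},\qquad [\mathrm{ad}_a,\mathrm{ad}_b]=2D_{a,b}-\mathrm{ad}_{[a,b]}$$ in $\mathfrak{so}(\mathrm{Im}\,\mathbb{O})$, while in $\mathfrak{so}(\mathbb{O})$ $$[D,L_a]=L_{Da},\qquad [D,R_a]=R_{Da},$$ $$[L_a,L_b]=\tfrac23D_{a,b}+\tfrac13L_{[a,b]}+\tfrac23R_{[a,b]},$$ $$[R_a,R_b]=\tfrac23D_{a,b}-\tfrac23L_{[a,b]}-\tfrac13R_{[a,b]},$$ $$[L_a,R_b]=-\tfrac13D_{a,b}+\tfrac13L_{[a,b]}-\tfrac13R_{[a,b]}.$$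 -/

import Mathlib

open scoped Quaternion TensorProduct
attribute [local instance 100] LieRing.ofAssociativeRing


noncomputable section

/-- The octonions, as pairs of real quaternions (Cayley–Dickson construction). -/
def Octonion : Type := ℍ[ℝ] × ℍ[ℝ]

namespace Octonion

instance : AddCommGroup Octonion := inferInstanceAs (AddCommGroup (ℍ[ℝ] × ℍ[ℝ]))

instance : Module ℝ Octonion := inferInstanceAs (Module ℝ (ℍ[ℝ] × ℍ[ℝ]))

/-- The octonion `(a, b)`. -/
def mk (a b : ℍ[ℝ]) : Octonion := (a, b)

/-- The first quaternionic component. -/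
def fst (x : Octonion) : ℍ[ℝ] := Prod.fst x

/-- The second quaternionic component. -/
def snd (x : Octonion) : ℍ[ℝ] := Prod.snd x

@[ext] theorem ext {x y : Octonion} (h₁ : x.fst = y.fst) (h₂ : x.snd = y.snd) : x = y :=
  Prod.ext h₁ h₂

/-- The unit `(1, 0)`. -/
instance : One Octonion := ⟨mk 1 0⟩

/-- The product `(a, b) (c, d) = (a c - d b*, a* d + c b)`. -/
instance : Mul Octonion :=
  ⟨fun x y => mk (x.fst * y.fst - y.snd * star x.snd) (star x.fst * y.snd + y.fst * x.snd)⟩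

/-- The conjugation `(a, b)* = (a*, -b)`. -/
instance : Star Octonion := ⟨fun x => mk (star x.fst) (-x.snd)⟩

@[simp] theorem fst_mk (a b : ℍ[ℝ]) : (mk a b).fst = a := rfl
@[simp] theorem snd_mk (a b : ℍ[ℝ]) : (mk a b).snd = b := rfl
@[simp] theorem fst_zero : (0 : Octonion).fst = 0 := rfl
@[simp] theorem snd_zero : (0 : Octonion).snd = 0 := rfl
@[simp] theorem fst_one : (1 : Octonion).fst = 1 := rfl
@[simp] theorem snd_one : (1 : Octonion).snd = 0 := rfl
@[simp] theorem fst_add (x y : Octonion) : (x + y).fst = x.fst + y.fst := rfl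
@[simp] theorem snd_add (x y : Octonion) : (x + y).snd = x.snd + y.snd := rfl
@[simp] theorem fst_neg (x : Octonion) : (-x).fst = -x.fst := rfl
@[simp] theorem snd_neg (x : Octonion) : (-x).snd = -x.snd := rfl
@[simp] theorem fst_sub (x y : Octonion) : (x - y).fst = x.fst - y.fst := rfl
@[simp] theorem snd_sub (x y : Octonion) : (x - y).snd = x.snd - y.snd := rfl
@[simp] theorem fst_smul (r : ℝ) (x : Octonion) : (r • x).fst = r • x.fst := rfl
@[simp] theorem snd_smul (r : ℝ) (x : Octonion) : (r • x).snd = r • x.snd := rfl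
@[simp] theorem fst_star (x : Octonion) : (star x).fst = star x.fst := rfl
@[simp] theorem snd_star (x : Octonion) : (star x).snd = -x.snd := rfl
@[simp] theorem fst_mul (x y : Octonion) :
    (x * y).fst = x.fst * y.fst - y.snd * star x.snd := rfl
@[simp] theorem snd_mul (x y : Octonion) :
    (x * y).snd = star x.fst * y.snd + y.fst * x.snd := rfl

instance : NonAssocRing Octonion where
  __ := (inferInstance : AddCommGroup Octonion)
  mul := (· * ·)
  one := 1
  left_distrib x y z := by ext1 <;> simp [mul_add, add_mul] <;> abel
  right_distrib x y z := by ext1 <;> simp [mul_add, add_mul] <;> abel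
  zero_mul x := by ext1 <;> simp
  mul_zero x := by ext1 <;> simp
  one_mul x := by ext1 <;> simp
  mul_one x := by ext1 <;> simp

instance : IsScalarTower ℝ Octonion Octonion where
  smul_assoc r x y := by ext1 <;> simp [smul_sub, smul_add]

instance : SMulCommClass ℝ Octonion Octonion where
  smul_comm r x y := by ext1 <;> simp [smul_sub, smul_add]

/-- The real part of an octonion. -/
def re (x : Octonion) : ℝ := x.fst.re

/-- The inner product `⟨x, y⟩ = Re (x* y)` as a bilinear form. -/
def innerForm : LinearMap.BilinForm ℝ Octonion :=
  LinearMap.mk₂ ℝ (fun x y => re (star x * y))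
    (fun x x' y => by simp [re]; ring)
    (fun r x y => by simp [re]; ring)
    (fun x y y' => by simp [re]; ring)
    (fun r x y => by simp [re]; ring)

/-- The space `Im 𝕆` of imaginary octonions. -/
def Im : Submodule ℝ Octonion where
  carrier := {x | star x = -x}
  add_mem' {x y} hx hy := by
    have hx' : star x = -x := hx
    have hy' : star y = -y := hy
    have h : star (x + y) = star x + star y := by ext1 <;> simp [add_comm]
    change star (x + y) = -(x + y)
    rw [h, hx', hy', neg_add]
  zero_mem' := by
    change star (0 : Octonion) = -0
    ext1 <;> simp
  smul_mem' r x hx := by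
    have hx' : star x = -x := hx
    have h : star (r • x) = r • star x := by ext1 <;> simp
    change star (r • x) = -(r • x)
    rw [h, hx', smul_neg]

/-- The Lie algebra `Der 𝕆` of derivations of the octonions. -/
def Der : LieSubalgebra ℝ (Module.End ℝ Octonion) where
  carrier := {D | ∀ x y : Octonion, D (x * y) = D x * y + x * D y}
  add_mem' {D E} hD hE x y := by
    simp only [LinearMap.add_apply, hD x y, hE x y, add_mul, mul_add]
    abel
  zero_mem' x y := by simp
  smul_mem' r D hD x y := by
    simp only [LinearMap.smul_apply, hD x y, smul_add, smul_mul_assoc, mul_smul_comm]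
  lie_mem' {D E} hD hE x y := by
    have hD' : ∀ x y : Octonion, D (x * y) = D x * y + x * D y := hD
    have hE' : ∀ x y : Octonion, E (x * y) = E x * y + x * E y := hE
    simp only [Ring.lie_def, LinearMap.sub_apply, Module.End.mul_apply, hD', hE', map_add,
      sub_mul, mul_sub]
    abel

/-- The Lie algebra `so(𝕆)` of skew-adjoint real-linear maps `𝕆 → 𝕆`. -/
abbrev so : LieSubalgebra ℝ (Module.End ℝ Octonion) :=
  skewAdjointLieSubalgebra innerForm

/-- The Lie algebra `so(Im 𝕆)` of skew-adjoint real-linear maps `Im 𝕆 → Im 𝕆`. -/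
abbrev soIm : LieSubalgebra ℝ (Module.End ℝ Im) :=
  skewAdjointLieSubalgebra (innerForm.restrict Im)

end Octonion

/-- The real Lie algebra `𝔤` is a compact real form of the complex Lie algebra `𝔤'`: its
complexification is isomorphic to `𝔤'`, and its Killing form is negative definite. -/
def IsCompactRealForm (𝔤 : Type*) [LieRing 𝔤] [LieAlgebra ℝ 𝔤]
    (𝔤' : Type*) [LieRing 𝔤'] [LieAlgebra ℂ 𝔤'] : Prop :=
  Nonempty (ℂ ⊗[ℝ] 𝔤 ≃ₗ⁅ℂ⁆ 𝔤') ∧ ∀ x : 𝔤, x ≠ 0 → killingForm ℝ 𝔤 x x < 0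

end

noncomputable section

/-! ### Real coordinates on the octonions. -/

namespace Octonion

/-! Everything about the octonions reduces to one explicit linear parametrization `derOf` of
$\mathrm{Der}(\mathbb{O})$ by $\mathbb{R}^{14}$. A derivation is determined by its values on $i$,
$j$, $l=(0,1)$, which generate $\mathbb{O}$. Differentiating the relations between these units
imposes ten linear conditions on 24 coordinates, so 14 remain (`derOf_surjective`,
`derOf_injective`). The coordinates are adapted to a maximal torus: the last two span the torus, and
the other twelve form six consecutive pairs, one for each pair of opposite roots. Brackets: the
associator is alternating, so $[L_a,L_b]$, $[R_a,R_b]$ and $[L_a,R_b]$ are combinations of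
$L_{[a,b]}$, $R_{[a,b]}$ and the associator $(a,b,\cdot)$. Since
$D_{a,b}=L_{[a,b]}-R_{[a,b]}-3(a,b,\cdot)$, eliminating the associator produces all the coefficients
in thirds. Decompositions: in $\mathfrak{so}(\mathrm{Im}\,\mathbb{O})$, of dimension 21, the
derivations are cut out by seven equations, each a signed sum of three matrix entries. On
$\mathrm{ad}_a$ these seven sums are $\pm 6$ times the coordinates of $a$, so they both detect and
produce the $\mathrm{ad}$-component. For $\mathfrak{so}(\mathbb{O})$, evaluation at $1$ reduces to
the previous case. Killing form: $-\mathrm{tr}(DE)$, the trace being over $\mathbb{O}$, is an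
invariant inner product on $\mathrm{Der}(\mathbb{O})$. Hence every $\mathrm{ad}\,D$ is skew, and the
trace of the square of a nonzero skew map is negative. The centre is zero, so the Killing form is
negative definite. Type $G_2$: the Serre relations alone force the presented algebra to be spanned
by six positive root vectors, six negative ones and two coroots, so its dimension is at most 14
(`finrank_g₂_le`). Explicit elements of $\mathbb{C}\otimes\mathrm{Der}(\mathbb{O})$ satisfy the same
relations (`isG2System_rootVec`) and generate this algebra of dimension 14. The induced homomorphism
is surjective onto a space at least as large as its source, hence an isomorphism. Neither the
simplicity nor the exact dimension of the presented algebra is needed beforehand. -/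

theorem coord_ext {x y : Octonion} (h0 : x.fst.re = y.fst.re) (h1 : x.fst.imI = y.fst.imI)
    (h2 : x.fst.imJ = y.fst.imJ) (h3 : x.fst.imK = y.fst.imK) (h4 : x.snd.re = y.snd.re)
    (h5 : x.snd.imI = y.snd.imI) (h6 : x.snd.imJ = y.snd.imJ) (h7 : x.snd.imK = y.snd.imK) :
    x = y :=
  Octonion.ext (QuaternionAlgebra.ext h0 h1 h2 h3) (QuaternionAlgebra.ext h4 h5 h6 h7)

section Coordinates

variable (x y : Octonion)

theorem re_fst_mul : (x * y).fst.re =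
    x.fst.re * y.fst.re - x.fst.imI * y.fst.imI - x.fst.imJ * y.fst.imJ - x.fst.imK * y.fst.imK
    - x.snd.re * y.snd.re - x.snd.imI * y.snd.imI - x.snd.imJ * y.snd.imJ
    - x.snd.imK * y.snd.imK := by
  simp; ring

theorem imI_fst_mul : (x * y).fst.imI =
    x.fst.re * y.fst.imI + x.fst.imI * y.fst.re + x.fst.imJ * y.fst.imK - x.fst.imK * y.fst.imJ
    + x.snd.imI * y.snd.re - x.snd.re * y.snd.imI + x.snd.imK * y.snd.imJ
    - x.snd.imJ * y.snd.imK := by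
  simp; ring

theorem imJ_fst_mul : (x * y).fst.imJ =
    x.fst.re * y.fst.imJ - x.fst.imI * y.fst.imK + x.fst.imJ * y.fst.re + x.fst.imK * y.fst.imI
    + x.snd.imJ * y.snd.re - x.snd.imK * y.snd.imI - x.snd.re * y.snd.imJ
    + x.snd.imI * y.snd.imK := by
  simp; ring

theorem imK_fst_mul : (x * y).fst.imK =
    x.fst.re * y.fst.imK + x.fst.imI * y.fst.imJ - x.fst.imJ * y.fst.imI + x.fst.imK * y.fst.re
    + x.snd.imK * y.snd.re + x.snd.imJ * y.snd.imI - x.snd.imI * y.snd.imJ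
    - x.snd.re * y.snd.imK := by
  simp; ring

theorem re_snd_mul : (x * y).snd.re =
    x.fst.re * y.snd.re + x.fst.imI * y.snd.imI + x.fst.imJ * y.snd.imJ + x.fst.imK * y.snd.imK
    + y.fst.re * x.snd.re - y.fst.imI * x.snd.imI - y.fst.imJ * x.snd.imJ
    - y.fst.imK * x.snd.imK := by
  simp; ring

theorem imI_snd_mul : (x * y).snd.imI =
    x.fst.re * y.snd.imI - x.fst.imI * y.snd.re - x.fst.imJ * y.snd.imK + x.fst.imK * y.snd.imJ
    + y.fst.re * x.snd.imI + y.fst.imI * x.snd.re + y.fst.imJ * x.snd.imK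
    - y.fst.imK * x.snd.imJ := by
  simp; ring

theorem imJ_snd_mul : (x * y).snd.imJ =
    x.fst.re * y.snd.imJ + x.fst.imI * y.snd.imK - x.fst.imJ * y.snd.re - x.fst.imK * y.snd.imI
    + y.fst.re * x.snd.imJ - y.fst.imI * x.snd.imK + y.fst.imJ * x.snd.re
    + y.fst.imK * x.snd.imI := by
  simp; ring

theorem imK_snd_mul : (x * y).snd.imK =
    x.fst.re * y.snd.imK - x.fst.imI * y.snd.imJ + x.fst.imJ * y.snd.imI - x.fst.imK * y.snd.re
    + y.fst.re * x.snd.imK + y.fst.imI * x.snd.imJ - y.fst.imJ * x.snd.imI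
    + y.fst.imK * x.snd.re := by
  simp; ring

end Coordinates

/-- The octonion with the given real coordinates. -/
def ofCoords (r₀ r₁ r₂ r₃ r₄ r₅ r₆ r₇ : ℝ) : Octonion := mk ⟨r₀, r₁, r₂, r₃⟩ ⟨r₄, r₅, r₆, r₇⟩

section

variable (r₀ r₁ r₂ r₃ r₄ r₅ r₆ r₇ : ℝ)

@[simp] theorem re_fst_ofCoords :
    (ofCoords r₀ r₁ r₂ r₃ r₄ r₅ r₆ r₇).fst.re = r₀ := rfl
@[simp] theorem imI_fst_ofCoords :
    (ofCoords r₀ r₁ r₂ r₃ r₄ r₅ r₆ r₇).fst.imI = r₁ := rfl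
@[simp] theorem imJ_fst_ofCoords :
    (ofCoords r₀ r₁ r₂ r₃ r₄ r₅ r₆ r₇).fst.imJ = r₂ := rfl
@[simp] theorem imK_fst_ofCoords :
    (ofCoords r₀ r₁ r₂ r₃ r₄ r₅ r₆ r₇).fst.imK = r₃ := rfl
@[simp] theorem re_snd_ofCoords :
    (ofCoords r₀ r₁ r₂ r₃ r₄ r₅ r₆ r₇).snd.re = r₄ := rfl
@[simp] theorem imI_snd_ofCoords :
    (ofCoords r₀ r₁ r₂ r₃ r₄ r₅ r₆ r₇).snd.imI = r₅ := rfl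
@[simp] theorem imJ_snd_ofCoords :
    (ofCoords r₀ r₁ r₂ r₃ r₄ r₅ r₆ r₇).snd.imJ = r₆ := rfl
@[simp] theorem imK_snd_ofCoords :
    (ofCoords r₀ r₁ r₂ r₃ r₄ r₅ r₆ r₇).snd.imK = r₇ := rfl

end

/-- The standard basis vectors of the octonions. -/
def unit : Fin 8 → Octonion :=
  ![ofCoords 1 0 0 0 0 0 0 0, ofCoords 0 1 0 0 0 0 0 0, ofCoords 0 0 1 0 0 0 0 0,
    ofCoords 0 0 0 1 0 0 0 0, ofCoords 0 0 0 0 1 0 0 0, ofCoords 0 0 0 0 0 1 0 0,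
    ofCoords 0 0 0 0 0 0 1 0, ofCoords 0 0 0 0 0 0 0 1]

theorem eq_sum_unit (x : Octonion) : x = x.fst.re • unit 0 + x.fst.imI • unit 1 +
    x.fst.imJ • unit 2 + x.fst.imK • unit 3 + x.snd.re • unit 4 + x.snd.imI • unit 5 +
    x.snd.imJ • unit 6 + x.snd.imK • unit 7 := by
  apply coord_ext <;> simp [unit]

theorem unit_zero : unit 0 = 1 := by
  apply coord_ext <;> simp [unit]

theorem linearMap_ext_unit {M : Type*} [AddCommGroup M] [Module ℝ M] {S T : Octonion →ₗ[ℝ] M}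
    (h : ∀ i, S (unit i) = T (unit i)) : S = T := by
  ext x
  rw [eq_sum_unit x]
  simp only [map_add, map_smul, h]

instance : FiniteDimensional ℝ Octonion := inferInstanceAs (FiniteDimensional ℝ (ℍ[ℝ] × ℍ[ℝ]))

/-! ### The coordinates of a derivation -/

/-- The derivation with coordinates `p`, as a function. -/
def derFun (p : Fin 14 → ℝ) (x : Octonion) : Octonion :=
  ofCoords 0
    ((-2 * p 7) * x.fst.imJ + (2 * p 6) * x.fst.imK + (2 * p 1) * x.snd.re
      + (-2 * p 0) * x.snd.imI + (-2 * p 5) * x.snd.imJ + (2 * p 4) * x.snd.imK)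
    (-(-2 * p 7) * x.fst.imI + (p 12 + p 13) * x.fst.imK + (p 4 - p 8) * x.snd.re
      + (-p 5 - p 9) * x.snd.imI + (p 0 - p 10) * x.snd.imJ + (-p 1 - p 11) * x.snd.imK)
    (-(2 * p 6) * x.fst.imI - (p 12 + p 13) * x.fst.imJ + (p 5 - p 9) * x.snd.re
      + (p 4 + p 8) * x.snd.imI + (p 1 - p 11) * x.snd.imJ + (p 0 + p 10) * x.snd.imK)
    (-(2 * p 1) * x.fst.imI - (p 4 - p 8) * x.fst.imJ - (p 5 - p 9) * x.fst.imK
      + p 12 * x.snd.imI + (p 2 - p 6) * x.snd.imJ + (p 3 - p 7) * x.snd.imK)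
    (-(-2 * p 0) * x.fst.imI - (-p 5 - p 9) * x.fst.imJ - (p 4 + p 8) * x.fst.imK
      - p 12 * x.snd.re + (-p 3 - p 7) * x.snd.imJ + (p 2 + p 6) * x.snd.imK)
    (-(-2 * p 5) * x.fst.imI - (p 0 - p 10) * x.fst.imJ - (p 1 - p 11) * x.fst.imK
      - (p 2 - p 6) * x.snd.re - (-p 3 - p 7) * x.snd.imI + p 13 * x.snd.imK)
    (-(2 * p 4) * x.fst.imI - (-p 1 - p 11) * x.fst.imJ - (p 0 + p 10) * x.fst.imK
      - (p 3 - p 7) * x.snd.re - (p 2 + p 6) * x.snd.imI - p 13 * x.snd.imJ)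

/-- The matrix of `derFun p` is skew with zero row and column at $1$. Coordinates 12 and 13 generate
a torus fixing $i$ and rotating the $(j,k)$, $(4,5)$ and $(6,7)$ planes with speeds $p_{12}+p_{13}$,
$p_{12}$ and $p_{13}$. -/
theorem derFun_mul (p : Fin 14 → ℝ) (x y : Octonion) :
    derFun p (x * y) = derFun p x * y + x * derFun p y := by
  apply coord_ext <;>
  simp only [fst_add, snd_add, Quaternion.re_add, Quaternion.imI_add, Quaternion.imJ_add,
    Quaternion.imK_add, derFun, re_fst_ofCoords, imI_fst_ofCoords, imJ_fst_ofCoords,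
    imK_fst_ofCoords, re_snd_ofCoords, imI_snd_ofCoords, imJ_snd_ofCoords, imK_snd_ofCoords,
    re_fst_mul, imI_fst_mul, imJ_fst_mul, imK_fst_mul,
    re_snd_mul, imI_snd_mul, imJ_snd_mul, imK_snd_mul] <;>
  ring

/-- The linear parametrization of the derivations by their coordinates. -/
def derOf : (Fin 14 → ℝ) →ₗ[ℝ] Der where
  toFun p := ⟨
    { toFun := derFun p
      map_add' := fun x y => by apply coord_ext <;> simp [derFun] <;> ring
      map_smul' := fun r x => by apply coord_ext <;> simp [derFun] <;> ring },
    derFun_mul p⟩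
  map_add' p q := by
    ext x : 2
    apply coord_ext <;> simp [derFun] <;> ring
  map_smul' r p := by
    ext x : 2
    apply coord_ext <;> simp [derFun] <;> ring

theorem derOf_apply (p : Fin 14 → ℝ) (x : Octonion) : (derOf p).1 x = derFun p x := rfl

end Octonion

namespace Octonion

/-! ### Every derivation has coordinates -/

/-- The units $i$, $j$, $l$ generate $\mathbb{O}$, so the Leibniz rule propagates equality to the
whole basis. -/
theorem derivation_ext_unit {D E : Der} (h1 : D.1 (unit 1) = E.1 (unit 1))
    (h2 : D.1 (unit 2) = E.1 (unit 2)) (h4 : D.1 (unit 4) = E.1 (unit 4)) : D = E := by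
  have hD := D.2
  have hE := E.2
  replace hD : ∀ x y, D.1 (x * y) = D.1 x * y + x * D.1 y := hD
  replace hE : ∀ x y, E.1 (x * y) = E.1 x * y + x * E.1 y := hE
  have mul_eq : ∀ {x y : Octonion}, D.1 x = E.1 x → D.1 y = E.1 y →
      D.1 (x * y) = E.1 (x * y) := fun hx hy => by rw [hD, hE, hx, hy]
  have e0 : unit 0 = -(unit 1 * unit 1) := by
    apply coord_ext <;> simp [unit]
  have e3 : unit 3 = unit 1 * unit 2 := by
    apply coord_ext <;> simp [unit]
  -- The sign comes from the conjugate in the second component of the product: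
  -- $(i,0)(0,1)=(0,i^*)=(0,-i)$.
  have e5 : unit 5 = -(unit 1 * unit 4) := by
    apply coord_ext <;> simp [unit]
  have e6 : unit 6 = -(unit 2 * unit 4) := by
    apply coord_ext <;> simp [unit]
  have e7 : unit 7 = -(unit 3 * unit 4) := by
    apply coord_ext <;> simp [unit]
  have h3 : D.1 (unit 3) = E.1 (unit 3) := by rw [e3, mul_eq h1 h2]
  ext1
  refine linearMap_ext_unit fun i => ?_
  fin_cases i
  · change D.1 (unit 0) = E.1 (unit 0)
    rw [e0, map_neg, map_neg, mul_eq h1 h1]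
  · exact h1
  · exact h2
  · exact h3
  · exact h4
  · change D.1 (unit 5) = E.1 (unit 5)
    rw [e5, map_neg, map_neg, mul_eq h1 h4]
  · change D.1 (unit 6) = E.1 (unit 6)
    rw [e6, map_neg, map_neg, mul_eq h2 h4]
  · change D.1 (unit 7) = E.1 (unit 7)
    rw [e7, map_neg, map_neg, mul_eq h3 h4]

theorem derivation_apply_one (D : Der) : D.1 1 = 0 := by
  have h : D.1 (1 * 1) = D.1 1 * 1 + 1 * D.1 1 := D.2 1 1
  simpa using h

/-- A derivation kills $1$, so it kills the scalar $xy+yx$. This encodes infinitesimal preservation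
of inner products of imaginary units before skewness is known. -/
theorem derivation_anticomm (D : Der) {x y : Octonion} {r : ℝ} (h : x * y + y * x = r • 1) :
    (D.1 x * y + x * D.1 y) + (D.1 y * x + y * D.1 x) = 0 := by
  have h1 : D.1 (x * y) = D.1 x * y + x * D.1 y := D.2 x y
  have h2 : D.1 (y * x) = D.1 y * x + y * D.1 x := D.2 y x
  rw [← h1, ← h2, ← map_add, h, map_smul, derivation_apply_one, smul_zero]

/-- The images of $i$, $j$, $l$ have 24 coordinates. Six conditions come from squares (no real part,
no component along the unit itself) and four from anticommutation of the pairs $(i,j)$, $(i,l)$,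
$(j,l)$, $(ij,l)$. This leaves 14 parameters. -/
theorem derOf_surjective : Function.Surjective derOf := by
  intro D
  have h11 := derivation_anticomm D (x := unit 1) (y := unit 1) (r := -2)
    (by apply coord_ext <;> simp [unit]; norm_num)
  have h22 := derivation_anticomm D (x := unit 2) (y := unit 2) (r := -2)
    (by apply coord_ext <;> simp [unit]; norm_num)
  have h44 := derivation_anticomm D (x := unit 4) (y := unit 4) (r := -2)
    (by apply coord_ext <;> simp [unit]; norm_num)
  have h12 := derivation_anticomm D (x := unit 1) (y := unit 2) (r := 0)
    (by apply coord_ext <;> simp [unit])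
  have h14 := derivation_anticomm D (x := unit 1) (y := unit 4) (r := 0)
    (by apply coord_ext <;> simp [unit])
  have h24 := derivation_anticomm D (x := unit 2) (y := unit 4) (r := 0)
    (by apply coord_ext <;> simp [unit])
  -- This condition involves the values at $i$, $j$ and $l$ together, once $D(ij)$ is expanded by
  -- the Leibniz rule.
  have h34 := derivation_anticomm D (x := unit 1 * unit 2) (y := unit 4) (r := 0)
    (by apply coord_ext <;> simp [unit])
  have h3 : D.1 (unit 1 * unit 2) = D.1 (unit 1) * unit 2 + unit 1 * D.1 (unit 2) :=
    D.2 (unit 1) (unit 2)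
  rw [h3] at h34
  have r1 := congrArg (fun z => z.fst.imI) h11
  have r2 := congrArg (fun z => z.fst.imJ) h22
  have r4 := congrArg (fun z => z.snd.re) h44
  have s1 := congrArg (fun z => z.fst.re) h11
  have s2 := congrArg (fun z => z.fst.re) h22
  have s4 := congrArg (fun z => z.fst.re) h44
  have s12 := congrArg (fun z => z.fst.re) h12
  have s14 := congrArg (fun z => z.fst.re) h14
  have s24 := congrArg (fun z => z.fst.re) h24
  have s34 := congrArg (fun z => z.fst.re) h34
  generalize hu1 : D.1 (unit 1) = u1 at *
  generalize hu2 : D.1 (unit 2) = u2 at *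
  generalize hu4 : D.1 (unit 4) = u4 at *
  simp [unit] at r1 r2 r4 s1 s2 s4 s12 s14 s24 s34
  -- The witness solves the entries of `derFun p` at the units 1, 2, 4 for `p`. The remaining
  -- entries agree by the ten conditions.
  refine ⟨![u1.snd.imI / 2, -u1.snd.re / 2, -u4.snd.imJ - u1.fst.imK / 2,
    -u4.snd.imK + u1.fst.imJ / 2, -u1.snd.imK / 2, u1.snd.imJ / 2, -u1.fst.imK / 2,
    u1.fst.imJ / 2, -u1.snd.imK / 2 + u2.snd.re, -u1.snd.imJ / 2 + u2.snd.imI,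
    u1.snd.imI / 2 + u2.snd.imJ, u1.snd.re / 2 + u2.snd.imK, -u4.snd.imI,
    -u2.fst.imK + u4.snd.imI], derivation_ext_unit ?_ ?_ ?_⟩
  · rw [derOf_apply, hu1]
    apply coord_ext <;> simp [derFun, unit] <;> linarith
  · rw [derOf_apply, hu2]
    apply coord_ext <;> simp [derFun, unit] <;> linarith
  · rw [derOf_apply, hu4]
    apply coord_ext <;> simp [derFun, unit] <;> linarith

theorem derOf_injective : Function.Injective derOf := by
  rw [← LinearMap.ker_eq_bot, LinearMap.ker_eq_bot']
  intro p hp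
  have h : ∀ x, derFun p x = 0 := fun x => by rw [← derOf_apply, hp]; rfl
  have h1 := h (unit 1)
  have h2 := h (unit 2)
  have h4 := h (unit 4)
  have a2 := congrArg (fun z => z.fst.imJ) h1
  have a3 := congrArg (fun z => z.fst.imK) h1
  have a4 := congrArg (fun z => z.snd.re) h1
  have a5 := congrArg (fun z => z.snd.imI) h1
  have a6 := congrArg (fun z => z.snd.imJ) h1
  have a7 := congrArg (fun z => z.snd.imK) h1
  have b3 := congrArg (fun z => z.fst.imK) h2
  have b4 := congrArg (fun z => z.snd.re) h2
  have b5 := congrArg (fun z => z.snd.imI) h2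
  have b6 := congrArg (fun z => z.snd.imJ) h2
  have b7 := congrArg (fun z => z.snd.imK) h2
  have c5 := congrArg (fun z => z.snd.imI) h4
  have c6 := congrArg (fun z => z.snd.imJ) h4
  have c7 := congrArg (fun z => z.snd.imK) h4
  simp [derFun, unit] at a2 a3 a4 a5 a6 a7 b3 b4 b5 b6 b7 c5 c6 c7
  ext i
  fin_cases i <;> simp <;> linarith

/-- The coordinates of a derivation. -/
def derEquiv : (Fin 14 → ℝ) ≃ₗ[ℝ] Der :=
  LinearEquiv.ofBijective derOf ⟨derOf_injective, derOf_surjective⟩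

instance : FiniteDimensional ℝ Der := derEquiv.finiteDimensional

theorem finrank_der : Module.finrank ℝ Der = 14 := by
  rw [← derEquiv.finrank_eq, Module.finrank_fin_fun]

end Octonion

namespace Octonion

/-! ### Alternativity -/

theorem assoc_swap_left (a b x : Octonion) :
    b * a * x - b * (a * x) = -(a * b * x - a * (b * x)) := by
  apply coord_ext <;>
  simp only [fst_sub, snd_sub, fst_neg, snd_neg, Quaternion.re_sub, Quaternion.imI_sub,
    Quaternion.imJ_sub, Quaternion.imK_sub, Quaternion.re_neg, Quaternion.imI_neg,
    Quaternion.imJ_neg, Quaternion.imK_neg, re_fst_mul, imI_fst_mul, imJ_fst_mul, imK_fst_mul,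
    re_snd_mul, imI_snd_mul, imJ_snd_mul, imK_snd_mul] <;>
  ring

theorem assoc_swap_right (a b x : Octonion) :
    a * x * b - a * (x * b) = -(a * b * x - a * (b * x)) := by
  apply coord_ext <;>
  simp only [fst_sub, snd_sub, fst_neg, snd_neg, Quaternion.re_sub, Quaternion.imI_sub,
    Quaternion.imJ_sub, Quaternion.imK_sub, Quaternion.re_neg, Quaternion.imI_neg,
    Quaternion.imJ_neg, Quaternion.imK_neg, re_fst_mul, imI_fst_mul, imJ_fst_mul, imK_fst_mul,
    re_snd_mul, imI_snd_mul, imJ_snd_mul, imK_snd_mul] <;>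
  ring

/-- In operator form $[L_a,L_b]=L_{[a,b]}-2(a,b,\cdot)$: two associators appear, and antisymmetry in
$a$, $b$ merges them. -/
theorem lmul_comm_lmul (a b x : Octonion) :
    a * (b * x) - b * (a * x) = (a * b - b * a) * x - (2 : ℝ) • (a * b * x - a * (b * x)) := by
  have h := assoc_swap_left a b x
  rw [sub_eq_iff_eq_add] at h
  rw [sub_mul, h]
  module

/-- In operator form $[R_a,R_b]=-R_{[a,b]}-2(a,b,\cdot)$. The associators $(x,b,a)$ and $(x,a,b)$
are brought to $(a,b,x)$ by transpositions. -/
theorem rmul_comm_rmul (a b x : Octonion) :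
    x * b * a - x * a * b = -(x * (a * b - b * a)) - (2 : ℝ) • (a * b * x - a * (b * x)) := by
  have h1 := assoc_swap_left a x b
  have h2 := assoc_swap_left b x a
  rw [assoc_swap_right a b x, neg_neg, sub_eq_iff_eq_add] at h1
  rw [assoc_swap_right b a x, assoc_swap_left a b x, neg_neg, sub_eq_iff_eq_add] at h2
  rw [mul_sub, h1, h2]
  module

theorem lmul_comm_rmul (a b x : Octonion) :
    a * (x * b) - a * x * b = a * b * x - a * (b * x) := by
  rw [← neg_sub, assoc_swap_right a b x, neg_neg]

/-! ### Imaginary octonions -/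

theorem mem_im_iff {x : Octonion} : x ∈ Im ↔ x.fst.re = 0 := by
  change star x = -x ↔ _
  constructor
  · intro h
    have h0 := congrArg (fun z => z.fst.re) h
    simp at h0
    linarith
  · intro h
    apply coord_ext <;> simp [h]

theorem re_coe_im (a : Im) : (a : Octonion).fst.re = 0 := mem_im_iff.1 a.2

theorem innerForm_apply (x y : Octonion) : innerForm x y =
    x.fst.re * y.fst.re + x.fst.imI * y.fst.imI + x.fst.imJ * y.fst.imJ + x.fst.imK * y.fst.imK
    + x.snd.re * y.snd.re + x.snd.imI * y.snd.imI + x.snd.imJ * y.snd.imJ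
    + x.snd.imK * y.snd.imK := by
  simp [innerForm, re]
  ring

theorem innerForm_comm (x y : Octonion) : innerForm x y = innerForm y x := by
  simp only [innerForm_apply]
  ring

theorem innerForm_self_pos {x : Octonion} (hx : x ≠ 0) : 0 < innerForm x x := by
  by_contra h
  apply hx
  rw [innerForm_apply] at h
  apply coord_ext <;> simp <;> nlinarith

theorem mem_so_iff {T : Module.End ℝ Octonion} :
    T ∈ so ↔ ∀ x y, innerForm (T x) y = -innerForm x (T y) := by
  refine (LinearMap.mem_skewAdjointSubmodule (B := innerForm) T).trans ?_
  simp [LinearMap.IsSkewAdjoint, LinearMap.IsAdjointPair]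
theorem mem_soIm_iff {T : Module.End ℝ Im} :
    T ∈ soIm ↔ ∀ x y : Im, innerForm (T x) (y : Octonion) = -innerForm (x : Octonion) (T y) := by
  refine (LinearMap.mem_skewAdjointSubmodule (B := innerForm.restrict Im) T).trans ?_
  simp [LinearMap.IsSkewAdjoint, LinearMap.IsAdjointPair]

/-- Left multiplication by an imaginary octonion. -/
def leftMul : Im →ₗ[ℝ] so where
  toFun a := ⟨LinearMap.mulLeft ℝ (a : Octonion), mem_so_iff.2 fun x y => by
    have ha := re_coe_im a
    simp only [LinearMap.mulLeft_apply, innerForm_apply, re_fst_mul, imI_fst_mul, imJ_fst_mul,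
      imK_fst_mul, re_snd_mul, imI_snd_mul, imJ_snd_mul, imK_snd_mul, ha]
    ring⟩
  map_add' a b := by ext x : 2; simp [add_mul]
  map_smul' r a := by ext x : 2; simp [smul_mul_assoc]

/-- Right multiplication by an imaginary octonion. -/
def rightMul : Im →ₗ[ℝ] so where
  toFun a := ⟨LinearMap.mulRight ℝ (a : Octonion), mem_so_iff.2 fun x y => by
    have ha := re_coe_im a
    simp only [LinearMap.mulRight_apply, innerForm_apply, re_fst_mul, imI_fst_mul, imJ_fst_mul,
      imK_fst_mul, re_snd_mul, imI_snd_mul, imJ_snd_mul, imK_snd_mul, ha]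
    ring⟩
  map_add' a b := by ext x : 2; simp [mul_add]
  map_smul' r a := by ext x : 2; simp [mul_smul_comm]

theorem leftMul_apply (a : Im) (x : Octonion) : (leftMul a).1 x = a * x := rfl

theorem rightMul_apply (a : Im) (x : Octonion) : (rightMul a).1 x = x * a := rfl

theorem commutator_mem_im (x y : Octonion) : x * y - y * x ∈ Im := by
  rw [mem_im_iff]
  simp only [fst_sub, Quaternion.re_sub, re_fst_mul]
  ring

/-- The commutator of imaginary octonions. -/
def imCommutator : Im →ₗ[ℝ] Im →ₗ[ℝ] Im :=
  LinearMap.mk₂ ℝ (fun a b => ⟨(a : Octonion) * b - b * a, commutator_mem_im _ _⟩)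
    (fun a a' b => by ext1; simp [add_mul, mul_add]; abel)
    (fun r a b => by ext1; simp [smul_sub, smul_mul_assoc, mul_smul_comm])
    (fun a b b' => by ext1; simp [add_mul, mul_add]; abel)
    (fun r a b => by ext1; simp [smul_sub, smul_mul_assoc, mul_smul_comm])

theorem coe_imCommutator (a b : Im) :
    (imCommutator a b : Octonion) = (a : Octonion) * b - b * a := rfl

/-- The adjoint map `x ↦ a x - x a` of an imaginary octonion. -/
def adIm : Im →ₗ[ℝ] soIm where
  toFun a := ⟨imCommutator a, mem_soIm_iff.2 fun x y => by
    have h1 := mem_so_iff.1 (leftMul a).2 x y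
    have h2 := mem_so_iff.1 (rightMul a).2 x y
    rw [leftMul_apply, leftMul_apply] at h1
    rw [rightMul_apply, rightMul_apply] at h2
    rw [coe_imCommutator, coe_imCommutator, map_sub, map_sub, LinearMap.sub_apply, h1, h2]
    ring⟩
  map_add' a b := by ext x : 2; simp
  map_smul' r a := by ext x : 2; simp

theorem coe_adIm_apply (a x : Im) : ((adIm a).1 x : Octonion) = (a : Octonion) * x - x * a := rfl

/-! ### Derivations and skew-adjoint maps -/

theorem derivation_apply_mem_im (D : Der) (x : Octonion) : D.1 x ∈ Im := by
  obtain ⟨p, rfl⟩ := derOf_surjective D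
  rw [mem_im_iff, derOf_apply]
  simp [derFun]

theorem derivation_mem_so (D : Der) : D.1 ∈ so := by
  obtain ⟨p, rfl⟩ := derOf_surjective D
  rw [mem_so_iff]
  intro x y
  simp only [derOf_apply, innerForm_apply, derFun, re_fst_ofCoords, imI_fst_ofCoords,
    imJ_fst_ofCoords, imK_fst_ofCoords, re_snd_ofCoords, imI_snd_ofCoords, imJ_snd_ofCoords,
    imK_snd_ofCoords]
  ring

/-- The restriction of derivations to the imaginary octonions. -/
def derToSoIm : Der →ₗ⁅ℝ⁆ soIm where
  toFun D := ⟨D.1.restrict fun x _ => derivation_apply_mem_im D x,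
    mem_soIm_iff.2 fun x y => mem_so_iff.1 (derivation_mem_so D) x y⟩
  map_add' _ _ := rfl
  map_smul' _ _ := rfl
  map_lie' := rfl

theorem coe_derToSoIm_apply (D : Der) (x : Im) : ((derToSoIm D).1 x : Octonion) = D.1 x := rfl

/-- The projection of the octonions onto their imaginary part. -/
def imProj : Octonion →ₗ[ℝ] Im where
  toFun x := ⟨x - x.fst.re • 1, by rw [mem_im_iff]; simp⟩
  map_add' x y := by ext1; simp [add_smul]; abel
  map_smul' r x := by ext1; simp [smul_sub, mul_smul]

theorem imProj_coe (x : Im) : imProj x = x := by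
  ext1
  simp [imProj, re_coe_im x]

theorem imProj_one : imProj 1 = 0 := by
  ext1
  simp [imProj]

theorem eq_re_add_imProj (x : Octonion) : x = x.fst.re • 1 + (imProj x : Octonion) := by
  simp [imProj]

theorem innerForm_imProj_right (x : Im) (y : Octonion) :
    innerForm (x : Octonion) (imProj y) = innerForm (x : Octonion) y := by
  simp [innerForm_apply, re_coe_im x, imProj]

theorem innerForm_imProj_left (x : Octonion) (y : Im) :
    innerForm (imProj x : Octonion) y = innerForm x (y : Octonion) := by
  rw [innerForm_comm, innerForm_imProj_right, innerForm_comm]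

/-- The extension of skew-adjoint maps of `Im 𝕆` by zero on `ℝ 1`. -/
def soImToSo : soIm →ₗ⁅ℝ⁆ so where
  toFun T := ⟨Im.subtype ∘ₗ T.1 ∘ₗ imProj, mem_so_iff.2 fun x y => by
    have h := mem_soIm_iff.1 T.2 (imProj x) (imProj y)
    rw [innerForm_imProj_right, innerForm_imProj_left] at h
    exact h⟩
  map_add' _ _ := rfl
  map_smul' _ _ := rfl
  map_lie' {S T} := by
    ext x : 2
    simp [LieRing.of_associative_ring_bracket, imProj_coe]

theorem soImToSo_apply (T : soIm) (x : Octonion) : (soImToSo T).1 x = T.1 (imProj x) := rfl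

theorem soImToSo_apply_one (T : soIm) : (soImToSo T).1 1 = 0 := by
  rw [soImToSo_apply, imProj_one, map_zero, Submodule.coe_zero]

theorem soImToSo_apply_coe (T : soIm) (x : Im) : (soImToSo T).1 (x : Octonion) = T.1 x := by
  rw [soImToSo_apply, imProj_coe]

theorem coe_soImToSo_derToSoIm (D : Der) : (soImToSo (derToSoIm D)).1 = D.1 := by
  ext1 x
  rw [soImToSo_apply, coe_derToSoIm_apply]
  conv_rhs => rw [eq_re_add_imProj x]
  rw [map_add, map_smul, derivation_apply_one, smul_zero, zero_add]

theorem soImToSo_injective : Function.Injective soImToSo := by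
  intro S T h
  ext x : 3
  rw [← soImToSo_apply_coe, h, soImToSo_apply_coe]

theorem derToSoIm_injective : Function.Injective derToSoIm := by
  intro D E h
  ext1
  rw [← coe_soImToSo_derToSoIm, h, coe_soImToSo_derToSoIm]

/-! ### Inner derivations. -/

theorem derivation_add_apply (D E : Der) (x : Octonion) : (D + E).1 x = D.1 x + E.1 x := rfl

theorem derivation_smul_apply (r : ℝ) (D : Der) (x : Octonion) : (r • D).1 x = r • D.1 x := rfl

/-- That the formula for $D_{a,b}$ is a derivation is proved by exhibiting its fourteen coordinates,
which are bilinear and alternating in $a$, $b$. -/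
theorem inner_derivation_eq (a b : Im) : ∃ D : Der, ∀ x : Octonion, D.1 x =
    ((imCommutator a b : Octonion) * x - x * imCommutator a b) -
      (3 : ℝ) • ((a : Octonion) * b * x - a * (b * x)) := by
  obtain ⟨a, ha⟩ := a
  obtain ⟨b, hb⟩ := b
  rw [mem_im_iff] at ha hb
  -- The witness is forced by `derOf_injective`: these are the coordinates read from the values of
  -- the right-hand side at $i$, $j$, $l$.
  refine ⟨derOf ![
    2 * (a.fst.imI * b.snd.imI - a.snd.imI * b.fst.imI)
      - (a.fst.imJ * b.snd.imJ - a.snd.imJ * b.fst.imJ)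
      - (a.fst.imK * b.snd.imK - a.snd.imK * b.fst.imK),
    -2 * (a.fst.imI * b.snd.re - a.snd.re * b.fst.imI)
      + (a.fst.imJ * b.snd.imK - a.snd.imK * b.fst.imJ)
      - (a.fst.imK * b.snd.imJ - a.snd.imJ * b.fst.imK),
    -3 * (a.snd.re * b.snd.imJ - a.snd.imJ * b.snd.re)
      - 3 * (a.snd.imI * b.snd.imK - a.snd.imK * b.snd.imI),
    -3 * (a.snd.re * b.snd.imK - a.snd.imK * b.snd.re)
      + 3 * (a.snd.imI * b.snd.imJ - a.snd.imJ * b.snd.imI),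
    -2 * (a.fst.imI * b.snd.imK - a.snd.imK * b.fst.imI)
      - (a.fst.imJ * b.snd.re - a.snd.re * b.fst.imJ)
      - (a.fst.imK * b.snd.imI - a.snd.imI * b.fst.imK),
    2 * (a.fst.imI * b.snd.imJ - a.snd.imJ * b.fst.imI)
      + (a.fst.imJ * b.snd.imI - a.snd.imI * b.fst.imJ)
      - (a.fst.imK * b.snd.re - a.snd.re * b.fst.imK),
    -2 * (a.fst.imI * b.fst.imK - a.fst.imK * b.fst.imI)
      + (a.snd.re * b.snd.imJ - a.snd.imJ * b.snd.re)
      - (a.snd.imI * b.snd.imK - a.snd.imK * b.snd.imI),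
    2 * (a.fst.imI * b.fst.imJ - a.fst.imJ * b.fst.imI)
      + (a.snd.re * b.snd.imK - a.snd.imK * b.snd.re)
      + (a.snd.imI * b.snd.imJ - a.snd.imJ * b.snd.imI),
    3 * (a.fst.imJ * b.snd.re - a.snd.re * b.fst.imJ)
      - 3 * (a.fst.imK * b.snd.imI - a.snd.imI * b.fst.imK),
    3 * (a.fst.imJ * b.snd.imI - a.snd.imI * b.fst.imJ)
      + 3 * (a.fst.imK * b.snd.re - a.snd.re * b.fst.imK),
    3 * (a.fst.imJ * b.snd.imJ - a.snd.imJ * b.fst.imJ)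
      - 3 * (a.fst.imK * b.snd.imK - a.snd.imK * b.fst.imK),
    3 * (a.fst.imJ * b.snd.imK - a.snd.imK * b.fst.imJ)
      + 3 * (a.fst.imK * b.snd.imJ - a.snd.imJ * b.fst.imK),
    -2 * (a.fst.imJ * b.fst.imK - a.fst.imK * b.fst.imJ)
      - 4 * (a.snd.re * b.snd.imI - a.snd.imI * b.snd.re)
      + 2 * (a.snd.imJ * b.snd.imK - a.snd.imK * b.snd.imJ),
    -2 * (a.fst.imJ * b.fst.imK - a.fst.imK * b.fst.imJ)
      + 2 * (a.snd.re * b.snd.imI - a.snd.imI * b.snd.re)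
      - 4 * (a.snd.imJ * b.snd.imK - a.snd.imK * b.snd.imJ)], fun x => ?_⟩
  rw [derOf_apply]
  apply coord_ext <;>
  simp only [coe_imCommutator, derFun, fst_sub, snd_sub, fst_smul, snd_smul, Quaternion.re_sub,
    Quaternion.imI_sub, Quaternion.imJ_sub, Quaternion.imK_sub, Quaternion.re_smul,
    Quaternion.imI_smul, Quaternion.imJ_smul, Quaternion.imK_smul, smul_eq_mul, re_fst_mul,
    imI_fst_mul, imJ_fst_mul, imK_fst_mul, re_snd_mul, imI_snd_mul, imJ_snd_mul, imK_snd_mul,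
    re_fst_ofCoords, imI_fst_ofCoords, imJ_fst_ofCoords, imK_fst_ofCoords, re_snd_ofCoords,
    imI_snd_ofCoords, imJ_snd_ofCoords, imK_snd_ofCoords, ha, hb, Matrix.cons_val] <;>
  ring

/-- The derivation `D_{a,b}`. -/
def innerDerFun (a b : Im) : Der := (inner_derivation_eq a b).choose

theorem innerDerFun_apply (a b : Im) (x : Octonion) : (innerDerFun a b).1 x =
    ((a * b - b * a : Octonion) * x - x * (a * b - b * a)) - (3 : ℝ) • (a * b * x - a * (b * x)) :=
  (inner_derivation_eq a b).choose_spec x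

/-- The bilinear map `(a, b) ↦ D_{a,b}`. -/
def innerDer : Im →ₗ[ℝ] Im →ₗ[ℝ] Der :=
  LinearMap.mk₂ ℝ innerDerFun
    (fun a a' b => by
      ext x : 2
      simp only [derivation_add_apply, innerDerFun_apply, Submodule.coe_add, add_mul, mul_add,
        sub_mul, mul_sub]
      module)
    (fun r a b => by
      ext x : 2
      simp only [derivation_smul_apply, innerDerFun_apply, Submodule.coe_smul, smul_mul_assoc,
        mul_smul_comm, sub_mul, mul_sub]
      module)
    (fun a b b' => by
      ext x : 2
      simp only [derivation_add_apply, innerDerFun_apply, Submodule.coe_add, add_mul, mul_add,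
        sub_mul, mul_sub]
      module)
    (fun r a b => by
      ext x : 2
      simp only [derivation_smul_apply, innerDerFun_apply, Submodule.coe_smul, smul_mul_assoc,
        mul_smul_comm, sub_mul, mul_sub]
      module)

theorem innerDer_apply (a b : Im) (x : Octonion) : (innerDer a b).1 x =
    ((imCommutator a b : Octonion) * x - x * imCommutator a b) -
      (3 : ℝ) • ((a : Octonion) * b * x - a * (b * x)) :=
  innerDerFun_apply a b x

end Octonion

namespace Octonion

/-! ### Brackets -/

theorem derivation_leibniz (D : Der) (x y : Octonion) : D.1 (x * y) = D.1 x * y + x * D.1 y :=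
  D.2 x y

theorem so_lie_apply (S T : so) (x : Octonion) : ⁅S, T⁆.1 x = S.1 (T.1 x) - T.1 (S.1 x) := rfl

theorem coe_soIm_lie_apply (S T : soIm) (x : Im) :
    (⁅S, T⁆.1 x : Octonion) = S.1 (T.1 x) - T.1 (S.1 x) := rfl

theorem lie_derToSoIm_adIm (D : Der) (a : Im) :
    ⁅derToSoIm D, adIm a⁆ = adIm ((derToSoIm D).1 a) := by
  ext x : 3
  simp only [coe_soIm_lie_apply, coe_adIm_apply, coe_derToSoIm_apply, map_sub, derivation_leibniz]
  abel

/-- Since $\mathrm{ad}_a=L_a-R_a$, the bracket expands into commutators of left and right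
multiplications. The alternativity identities turn each of them into multiplications by $ab$ and
$ba$ and the associator $(a,b,\cdot)$. -/
theorem lie_adIm_adIm (a b : Im) :
    ⁅adIm a, adIm b⁆ = (2 : ℝ) • derToSoIm (innerDer a b) - adIm (imCommutator a b) := by
  ext x : 3
  have h1 := assoc_swap_left (a : Octonion) b x
  have h2 := rmul_comm_rmul (a : Octonion) b x
  have h3 := lmul_comm_rmul (a : Octonion) b x
  have h4 := lmul_comm_rmul (b : Octonion) a x
  rw [assoc_swap_left] at h4
  change ((⁅adIm a, adIm b⁆.1 x : Im) : Octonion) =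
    (2 : ℝ) • ((derToSoIm (innerDer a b)).1 x : Octonion) - ((adIm (imCommutator a b)).1 x : Im)
  simp only [coe_soIm_lie_apply, coe_adIm_apply, coe_derToSoIm_apply, innerDer_apply,
    coe_imCommutator, mul_sub, sub_mul] at *
  rw [sub_eq_iff_eq_add] at h1 h2 h3 h4
  rw [h1, h2, h3, h4]
  module

theorem lie_derivation_leftMul (D : Der) (a : Im) :
    ⁅soImToSo (derToSoIm D), leftMul a⁆ = leftMul ((derToSoIm D).1 a) := by
  ext x : 2
  rw [so_lie_apply, coe_soImToSo_derToSoIm]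
  simp only [leftMul_apply, coe_derToSoIm_apply, derivation_leibniz]
  abel

theorem lie_derivation_rightMul (D : Der) (a : Im) :
    ⁅soImToSo (derToSoIm D), rightMul a⁆ = rightMul ((derToSoIm D).1 a) := by
  ext x : 2
  rw [so_lie_apply, coe_soImToSo_derToSoIm]
  simp only [rightMul_apply, coe_derToSoIm_apply, derivation_leibniz]
  abel

theorem so_add_apply (S T : so) (x : Octonion) : (S + T).1 x = S.1 x + T.1 x := rfl

theorem so_sub_apply (S T : so) (x : Octonion) : (S - T).1 x = S.1 x - T.1 x := rfl

theorem so_smul_apply (r : ℝ) (S : so) (x : Octonion) : (r • S).1 x = r • S.1 x := rfl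

/-- Substitute $(a,b,\cdot)=\tfrac13(L_{[a,b]}-R_{[a,b]}-D_{a,b})$ into `lmul_comm_lmul`. The next
two brackets arise in the same way. -/
theorem lie_leftMul_leftMul (a b : Im) : ⁅leftMul a, leftMul b⁆ =
    (2 / 3 : ℝ) • soImToSo (derToSoIm (innerDer a b)) + (1 / 3 : ℝ) • leftMul (imCommutator a b) +
      (2 / 3 : ℝ) • rightMul (imCommutator a b) := by
  ext x : 2
  simp only [so_add_apply, so_smul_apply, so_lie_apply, leftMul_apply, rightMul_apply,
    coe_soImToSo_derToSoIm, innerDer_apply]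
  rw [lmul_comm_lmul, coe_imCommutator]
  module

theorem lie_rightMul_rightMul (a b : Im) : ⁅rightMul a, rightMul b⁆ =
    (2 / 3 : ℝ) • soImToSo (derToSoIm (innerDer a b)) - (2 / 3 : ℝ) • leftMul (imCommutator a b) -
      (1 / 3 : ℝ) • rightMul (imCommutator a b) := by
  ext x : 2
  simp only [so_sub_apply, so_smul_apply, so_lie_apply, leftMul_apply, rightMul_apply,
    coe_soImToSo_derToSoIm, innerDer_apply]
  rw [rmul_comm_rmul, coe_imCommutator]
  module

theorem lie_leftMul_rightMul (a b : Im) : ⁅leftMul a, rightMul b⁆ =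
    -(1 / 3 : ℝ) • soImToSo (derToSoIm (innerDer a b)) + (1 / 3 : ℝ) • leftMul (imCommutator a b) -
      (1 / 3 : ℝ) • rightMul (imCommutator a b) := by
  ext x : 2
  simp only [so_add_apply, so_sub_apply, so_smul_apply, so_lie_apply, leftMul_apply,
    rightMul_apply, coe_soImToSo_derToSoIm, innerDer_apply]
  rw [lmul_comm_rmul, coe_imCommutator]
  module

/-! ### Decompositions -/

theorem leftMul_injective : Function.Injective leftMul := by
  intro a b h
  have h1 : (leftMul a).1 1 = (leftMul b).1 1 := by rw [h]
  rw [leftMul_apply, leftMul_apply, mul_one, mul_one] at h1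
  exact Subtype.ext h1

theorem rightMul_injective : Function.Injective rightMul := by
  intro a b h
  have h1 : (rightMul a).1 1 = (rightMul b).1 1 := by rw [h]
  rw [rightMul_apply, rightMul_apply, one_mul, one_mul] at h1
  exact Subtype.ext h1

/-- For each coordinate of $a$ there is a signed sum of three matrix entries that vanishes on every
derivation and equals $\pm 6$ times that coordinate on $\mathrm{ad}_a$. -/
theorem eq_zero_of_derToSoIm_eq_adIm {D : Der} {a : Im} (h : derToSoIm D = adIm a) : a = 0 := by
  obtain ⟨p, rfl⟩ := derOf_surjective D
  have key : ∀ x : Octonion, x ∈ Im → derFun p x = (a : Octonion) * x - x * a := fun x hx => by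
    rw [← coe_adIm_apply a ⟨x, hx⟩, ← h]
    rfl
  have h0 := re_coe_im a
  obtain ⟨a, ha⟩ := a
  simp only at key h0
  have h2 := key (unit 2) (by simp [mem_im_iff, unit])
  have h3 := key (unit 3) (by simp [mem_im_iff, unit])
  have h4 := key (unit 4) (by simp [mem_im_iff, unit])
  have h5 := key (unit 5) (by simp [mem_im_iff, unit])
  have h6 := key (unit 6) (by simp [mem_im_iff, unit])
  have h7 := key (unit 7) (by simp [mem_im_iff, unit])
  -- These are the 21 entries above the diagonal of the two matrices on $\mathrm{Im}\,\mathbb{O}$.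
  -- They are linear equations in 14 derivation coordinates and 7 coordinates of $a$.
  have t12 := congrArg (fun z => z.fst.imI) h2
  have t13 := congrArg (fun z => z.fst.imI) h3
  have t23 := congrArg (fun z => z.fst.imJ) h3
  have t14 := congrArg (fun z => z.fst.imI) h4
  have t24 := congrArg (fun z => z.fst.imJ) h4
  have t34 := congrArg (fun z => z.fst.imK) h4
  have t15 := congrArg (fun z => z.fst.imI) h5
  have t25 := congrArg (fun z => z.fst.imJ) h5
  have t35 := congrArg (fun z => z.fst.imK) h5
  have t45 := congrArg (fun z => z.snd.re) h5
  have t16 := congrArg (fun z => z.fst.imI) h6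
  have t26 := congrArg (fun z => z.fst.imJ) h6
  have t36 := congrArg (fun z => z.fst.imK) h6
  have t46 := congrArg (fun z => z.snd.re) h6
  have t56 := congrArg (fun z => z.snd.imI) h6
  have t17 := congrArg (fun z => z.fst.imI) h7
  have t27 := congrArg (fun z => z.fst.imJ) h7
  have t37 := congrArg (fun z => z.fst.imK) h7
  have t47 := congrArg (fun z => z.snd.re) h7
  have t57 := congrArg (fun z => z.snd.imI) h7
  have t67 := congrArg (fun z => z.snd.imJ) h7
  simp [derFun, unit] at t12 t13 t14 t15 t16 t17 t23 t24 t25 t26 t27 t34 t35 t36 t37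
  simp [derFun, unit] at t45 t46 t47 t56 t57 t67
  ext1
  apply coord_ext
  · exact h0
  · change a.fst.imI = 0
    linarith
  · change a.fst.imJ = 0
    linarith
  · change a.fst.imK = 0
    linarith
  · change a.snd.re = 0
    linarith
  · change a.snd.imI = 0
    linarith
  · change a.snd.imJ = 0
    linarith
  · change a.snd.imK = 0
    linarith

theorem adIm_injective : Function.Injective adIm := by
  rw [← LinearMap.ker_eq_bot, LinearMap.ker_eq_bot']
  intro a ha
  exact eq_zero_of_derToSoIm_eq_adIm (D := 0) (by rw [ha, map_zero])

theorem innerForm_unit_right (x : Octonion) (i : Fin 8) : innerForm x (unit i) =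
    ![x.fst.re, x.fst.imI, x.fst.imJ, x.fst.imK, x.snd.re, x.snd.imI, x.snd.imJ, x.snd.imK] i := by
  fin_cases i <;> simp [innerForm_apply, unit]

theorem innerForm_unit_left (x : Octonion) (i : Fin 8) : innerForm (unit i) x =
    ![x.fst.re, x.fst.imI, x.fst.imJ, x.fst.imK, x.snd.re, x.snd.imI, x.snd.imJ, x.snd.imK] i := by
  rw [innerForm_comm, innerForm_unit_right]

set_option maxHeartbeats 1000000 in
theorem exists_derToSoIm_add_adIm (T : soIm) : ∃ D a, derToSoIm D + adIm a = T := by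
  -- Extending by zero to $\mathbb{O}$ lets the matrix be indexed by all eight units. The column at
  -- $1$ vanishes, and by skewness so does the row.
  obtain ⟨U, hU⟩ : ∃ U : so, U = soImToSo T := ⟨_, rfl⟩
  have hU0 : U.1 (unit 0) = 0 := by rw [unit_zero, hU, soImToSo_apply_one]
  have s : ∀ i j, innerForm (U.1 (unit i)) (unit j) = -innerForm (unit i) (U.1 (unit j)) :=
    fun i j => mem_so_iff.1 U.2 _ _
  obtain ⟨u, hu⟩ : ∃ u : Fin 8 → Octonion, ∀ i, U.1 (unit i) = u i := ⟨_, fun _ => rfl⟩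
  simp only [hu, innerForm_unit_left, innerForm_unit_right] at s hU0
  have s01 := s 0 1
  have s02 := s 0 2
  have s03 := s 0 3
  have s04 := s 0 4
  have s05 := s 0 5
  have s06 := s 0 6
  have s07 := s 0 7
  have s11 := s 1 1
  have s12 := s 1 2
  have s13 := s 1 3
  have s14 := s 1 4
  have s15 := s 1 5
  have s16 := s 1 6
  have s17 := s 1 7
  have s22 := s 2 2
  have s23 := s 2 3
  have s24 := s 2 4
  have s25 := s 2 5
  have s26 := s 2 6
  have s27 := s 2 7
  have s33 := s 3 3
  have s34 := s 3 4
  have s35 := s 3 5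
  have s36 := s 3 6
  have s37 := s 3 7
  have s44 := s 4 4
  have s45 := s 4 5
  have s46 := s 4 6
  have s47 := s 4 7
  have s55 := s 5 5
  have s56 := s 5 6
  have s57 := s 5 7
  have s66 := s 6 6
  have s67 := s 6 7
  have s77 := s 7 7
  clear s
  -- Each relation now rewrites an entry on one side of the diagonal by its mirror image, so that 21
  -- free entries remain.
  simp only [Matrix.cons_val] at s11 s12 s13 s14 s15 s16 s17 s22 s23 s24 s25 s26 s27 s33 s34
  simp only [Matrix.cons_val] at s35 s36 s37 s44 s45 s46 s47 s55 s56 s57 s66 s67 s77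
  simp only [Matrix.cons_val, hU0, fst_zero, snd_zero, Quaternion.re_zero, Quaternion.imI_zero,
    Quaternion.imJ_zero, Quaternion.imK_zero] at s01 s02 s03 s04 s05 s06 s07
  rw [zero_eq_neg] at s01 s02 s03 s04 s05 s06 s07
  rw [self_eq_neg] at s11 s22 s33 s44 s55 s66 s77
  -- Each coordinate is one sixth of a signed sum of three entries vanishing on derivations. On
  -- $\mathrm{ad}_a$ the three terms contribute equally, each twice the coordinate of $a$ up to a
  -- common sign.
  obtain ⟨a, ha⟩ : ∃ a : Octonion, a = ofCoords 0
    (-((u 3).fst.imJ - (u 5).snd.re - (u 7).snd.imJ) / 6)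
    (((u 3).fst.imI + (u 6).snd.re - (u 7).snd.imI) / 6)
    (-((u 2).fst.imI - (u 7).snd.re - (u 6).snd.imI) / 6)
    (-((u 5).fst.imI + (u 6).fst.imJ + (u 7).fst.imK) / 6)
    (((u 4).fst.imI + (u 7).fst.imJ - (u 6).fst.imK) / 6)
    (-((u 7).fst.imI - (u 4).fst.imJ - (u 5).fst.imK) / 6)
    (((u 6).fst.imI - (u 5).fst.imJ + (u 4).fst.imK) / 6) := ⟨_, rfl⟩
  have haIm : a ∈ Im := by rw [mem_im_iff, ha]; simp
  obtain ⟨p, hp⟩ : ∃ p : Fin 14 → ℝ, ∀ i, derFun p (unit i) + (a * unit i - unit i * a) = u i := by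
    -- These are the coordinates of the derivation left after subtracting $\mathrm{ad}_a$.
    refine ⟨![
      (-2 * (u 5).fst.imI + (u 6).fst.imJ + (u 7).fst.imK) / 6,
      (2 * (u 4).fst.imI - (u 7).fst.imJ + (u 6).fst.imK) / 6,
      (3 * (u 6).snd.re + 3 * (u 7).snd.imI) / 6,
      (3 * (u 7).snd.re - 3 * (u 6).snd.imI) / 6,
      (2 * (u 7).fst.imI + (u 4).fst.imJ + (u 5).fst.imK) / 6,
      (-2 * (u 6).fst.imI - (u 5).fst.imJ + (u 4).fst.imK) / 6,
      (2 * (u 3).fst.imI - (u 6).snd.re + (u 7).snd.imI) / 6,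
      (-2 * (u 2).fst.imI - (u 7).snd.re - (u 6).snd.imI) / 6,
      (-3 * (u 4).fst.imJ + 3 * (u 5).fst.imK) / 6,
      (-3 * (u 5).fst.imJ - 3 * (u 4).fst.imK) / 6,
      (-3 * (u 6).fst.imJ + 3 * (u 7).fst.imK) / 6,
      (-3 * (u 7).fst.imJ - 3 * (u 6).fst.imK) / 6,
      (2 * (u 3).fst.imJ + 4 * (u 5).snd.re - 2 * (u 7).snd.imJ) / 6,
      (2 * (u 3).fst.imJ - 2 * (u 5).snd.re + 4 * (u 7).snd.imJ) / 6], fun i => ?_⟩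
    fin_cases i <;> apply coord_ext <;>
    simp only [Fin.zero_eta, Fin.mk_one, Fin.reduceFinMk, ha, derFun, unit, hU0, fst_zero,
      snd_zero, Quaternion.re_zero, Quaternion.imI_zero, Quaternion.imJ_zero, Quaternion.imK_zero,
      Matrix.cons_val, fst_sub, snd_sub, fst_add, snd_add,
      Quaternion.re_sub, Quaternion.imI_sub, Quaternion.imJ_sub, Quaternion.imK_sub,
      Quaternion.re_add, Quaternion.imI_add, Quaternion.imJ_add, Quaternion.imK_add,
      re_fst_mul, imI_fst_mul, imJ_fst_mul, imK_fst_mul, re_snd_mul, imI_snd_mul, imJ_snd_mul,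
      imK_snd_mul, re_fst_ofCoords, imI_fst_ofCoords, imJ_fst_ofCoords, imK_fst_ofCoords,
      re_snd_ofCoords, imI_snd_ofCoords, imJ_snd_ofCoords, imK_snd_ofCoords,
      s01, s02, s03, s04, s05, s06, s07, s11, s12, s13, s14, s15, s16, s17,
      s22, s23, s24, s25, s26, s27, s33, s34, s35, s36, s37, s44, s45, s46,
      s47, s55, s56, s57, s66, s67, s77] <;>
    ring
  refine ⟨derOf p, ⟨a, haIm⟩, ?_⟩
  have hlin : (derOf p).1 + (LinearMap.mulLeft ℝ a - LinearMap.mulRight ℝ a) = U.1 :=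
    linearMap_ext_unit fun i => by rw [hu, ← hp i]; rfl
  ext x : 3
  rw [← soImToSo_apply_coe T, ← hU, ← hlin]
  rfl

theorem isCompl_der_adIm :
    IsCompl (LinearMap.range (derToSoIm : Der →ₗ[ℝ] soIm)) (LinearMap.range adIm) := by
  constructor
  · rw [Submodule.disjoint_def]
    rintro _ ⟨D, rfl⟩ ⟨a, ha⟩
    have h0 := eq_zero_of_derToSoIm_eq_adIm ha.symm
    rw [← ha, h0, map_zero]
  · rw [codisjoint_iff, eq_top_iff]
    intro T _
    obtain ⟨D, a, rfl⟩ := exists_derToSoIm_add_adIm T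
    exact Submodule.add_mem_sup ⟨D, rfl⟩ ⟨a, rfl⟩

/-- Evaluation at $1$ gives $b=-a$. The relation then says that $D$ restricts to $\mathrm{ad}_{-a}$,
which forces $a=0$ by the case of $\mathrm{Im}\,\mathbb{O}$. -/
theorem eq_zero_of_derivation_add_leftMul_add_rightMul {D : Der} {a b : Im}
    (h : soImToSo (derToSoIm D) + leftMul a + rightMul b = 0) : D = 0 ∧ a = 0 ∧ b = 0 := by
  have key : ∀ x, D.1 x + a * x + x * b = 0 := fun x => by
    have hx : (soImToSo (derToSoIm D) + leftMul a + rightMul b).1 x = 0 := by rw [h]; rfl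
    rwa [so_add_apply, so_add_apply, coe_soImToSo_derToSoIm] at hx
  have hb : b = -a := by
    have h1 := key 1
    rw [derivation_apply_one, mul_one, one_mul, zero_add, add_comm] at h1
    exact Subtype.ext (eq_neg_of_add_eq_zero_left h1)
  subst hb
  have ha : -a = 0 := by
    refine eq_zero_of_derToSoIm_eq_adIm (D := D) ?_
    ext x : 3
    rw [coe_derToSoIm_apply, coe_adIm_apply]
    have hx := key x
    rw [Submodule.coe_neg, mul_neg] at *
    rw [add_assoc] at hx
    rw [eq_neg_of_add_eq_zero_left hx, neg_mul]
    abel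
  have ha' : a = 0 := neg_eq_zero.1 ha
  subst ha'
  refine ⟨?_, rfl, neg_zero⟩
  apply derToSoIm_injective
  ext x : 3
  rw [coe_derToSoIm_apply, map_zero]
  simpa using key x

/-- With $c=T(1)$, which skewness makes imaginary, the map $\tfrac12(L_c+R_c)$ also sends $1$ to
$c$. The difference kills $1$, hence preserves $\mathrm{Im}\,\mathbb{O}$, and there it is
$D+\mathrm{ad}_a$ with $\mathrm{ad}_a=L_a-R_a$. -/
theorem exists_derivation_add_leftMul_add_rightMul (T : so) :
    ∃ D a b, soImToSo (derToSoIm D) + leftMul a + rightMul b = T := by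
  have skew := mem_so_iff.1 T.2
  have re_eq : ∀ x : Octonion, x.fst.re = innerForm x 1 := fun x => by simp [innerForm_apply]
  have hc : T.1 1 ∈ Im := by
    rw [mem_im_iff, re_eq]
    have h := skew 1 1
    rw [innerForm_comm 1] at h
    linarith
  obtain ⟨c, hc⟩ : ∃ c : Im, (c : Octonion) = T.1 1 := ⟨⟨_, hc⟩, rfl⟩
  obtain ⟨S, hS⟩ : ∃ S : so, S = T - leftMul ((1 / 2 : ℝ) • c) - rightMul ((1 / 2 : ℝ) • c) :=
    ⟨_, rfl⟩
  have hS1 : S.1 1 = 0 := by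
    rw [hS, so_sub_apply, so_sub_apply, leftMul_apply, rightMul_apply, ← hc, Submodule.coe_smul,
      mul_one, one_mul]
    module
  have hSim : ∀ x, S.1 x ∈ Im := fun x => by
    rw [mem_im_iff, re_eq, mem_so_iff.1 S.2, hS1, map_zero, neg_zero]
  obtain ⟨D, a, hDa⟩ := exists_derToSoIm_add_adIm
    ⟨S.1.restrict fun x _ => hSim x, mem_soIm_iff.2 fun x y => mem_so_iff.1 S.2 x y⟩
  refine ⟨D, a + (1 / 2 : ℝ) • c, -a + (1 / 2 : ℝ) • c, ?_⟩
  have hx : ∀ x : Im, D.1 x + ((a : Octonion) * x - x * a) = S.1 x := fun x => by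
    have h := congrArg (fun U : soIm => (U.1 x : Octonion)) hDa
    exact h
  have hS' : soImToSo (derToSoIm D) + leftMul a - rightMul a = S := by
    ext x : 2
    rw [so_sub_apply, so_add_apply, coe_soImToSo_derToSoIm, leftMul_apply, rightMul_apply,
      eq_re_add_imProj x]
    simp only [map_add, map_smul, derivation_apply_one, hS1, ← hx, mul_add, add_mul,
      mul_smul_comm, smul_mul_assoc, mul_one, one_mul]
    module
  rw [map_add, map_add, map_neg]
  rw [hS, eq_sub_iff_add_eq, eq_sub_iff_add_eq] at hS'
  rw [← hS']
  abel

theorem iSupIndep_fin_three {M : Type*} [AddCommGroup M] [Module ℝ M] {A B C : Submodule ℝ M}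
    (h : ∀ x ∈ A, ∀ y ∈ B, ∀ z ∈ C, x + y + z = 0 → x = 0 ∧ y = 0 ∧ z = 0) :
    iSupIndep ![A, B, C] := by
  rw [iSupIndep_iff_finsetSum_eq_zero_imp_eq_zero]
  intro s v hv hsum i hi
  -- The family is extended by zero outside `s` so that the sum always has three terms.
  obtain ⟨w, hw⟩ : ∃ w : Fin 3 → M, ∀ i, w i = if i ∈ s then v i else 0 := ⟨_, fun _ => rfl⟩
  have hwm : ∀ i, w i ∈ ![A, B, C] i := fun i => by
    rw [hw]
    split_ifs with his
    · exact hv i his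
    · exact zero_mem _
  have hwsum : w 0 + w 1 + w 2 = 0 := by
    rw [← Fin.sum_univ_three, ← hsum]
    simp [hw]
  obtain ⟨h0, h1, h2⟩ := h _ (hwm 0) _ (hwm 1) _ (hwm 2) hwsum
  have hz : w i = 0 := by fin_cases i <;> assumption
  rwa [hw, if_pos hi] at hz

theorem isInternal_der_leftMul_rightMul : DirectSum.IsInternal
    ![LinearMap.range ((soImToSo.comp derToSoIm : Der →ₗ⁅ℝ⁆ so) : Der →ₗ[ℝ] so),
      LinearMap.range leftMul, LinearMap.range rightMul] := by
  rw [DirectSum.isInternal_submodule_iff_iSupIndep_and_iSup_eq_top]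
  constructor
  · apply iSupIndep_fin_three
    rintro _ ⟨D, rfl⟩ _ ⟨a, rfl⟩ _ ⟨b, rfl⟩ h
    obtain ⟨rfl, rfl, rfl⟩ := eq_zero_of_derivation_add_leftMul_add_rightMul h
    simp
  · rw [eq_top_iff]
    intro T _
    obtain ⟨D, a, b, rfl⟩ := exists_derivation_add_leftMul_add_rightMul T
    refine add_mem (add_mem ?_ ?_) ?_
    · exact Submodule.mem_iSup_of_mem 0 ⟨D, rfl⟩
    · exact Submodule.mem_iSup_of_mem 1 ⟨a, rfl⟩
    · exact Submodule.mem_iSup_of_mem 2 ⟨b, rfl⟩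

end Octonion

/-! ### Traces of squares of skew-adjoint maps -/

section TraceSquare

variable {V : Type*} [AddCommGroup V] [Module ℝ V] [FiniteDimensional ℝ V]

/-- In an orthogonal basis $v_i$ the trace of $T^2$ is $\sum_i B(T^2v_i,v_i)/B(v_i,v_i)=-\sum_i
B(Tv_i,Tv_i)/B(v_i,v_i)$, and some $Tv_i$ is nonzero. -/
theorem trace_mul_self_neg_of_skew (B : LinearMap.BilinForm ℝ V) (hsymm : ∀ x y, B x y = B y x)
    (hpos : ∀ x, x ≠ 0 → 0 < B x x) {T : Module.End ℝ V} (hT : ∀ x y, B (T x) y = -B x (T y))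
    (hT0 : T ≠ 0) : LinearMap.trace ℝ V (T * T) < 0 := by
  have hnonneg : ∀ x, 0 ≤ B x x := fun x => by
    by_cases hx : x = 0
    · simp [hx]
    · exact (hpos x hx).le
  obtain ⟨v, hv⟩ := LinearMap.BilinForm.exists_orthogonal_basis (B := B) ⟨hsymm⟩
  have hne : ∀ i, 0 < B (v i) (v i) := fun i => hpos _ (v.ne_zero i)
  have hrepr : ∀ x i, v.repr x i * B (v i) (v i) = B x (v i) := fun x i => by
    conv_rhs => rw [← v.sum_repr x]
    rw [map_sum, LinearMap.sum_apply, Finset.sum_eq_single i]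
    · simp
    · intro j _ hji
      have : B (v j) (v i) = 0 := hv hji
      simp [this]
    · simp
  have htr : LinearMap.trace ℝ V (T * T) = ∑ i, -(B (T (v i)) (T (v i)) / B (v i) (v i)) := by
    rw [LinearMap.trace_eq_matrix_trace ℝ v, Matrix.trace]
    refine Finset.sum_congr rfl fun i _ => ?_
    rw [Matrix.diag_apply, LinearMap.toMatrix_apply, Module.End.mul_apply,
      eq_div_of_mul_eq (hne i).ne' (hrepr _ i), hT, neg_div]
  rw [htr]
  obtain ⟨i, hi⟩ : ∃ i, T (v i) ≠ 0 := by
    by_contra! h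
    exact hT0 (v.ext fun i => by rw [h i, LinearMap.zero_apply])
  refine Finset.sum_neg' (fun j _ => ?_) ⟨i, Finset.mem_univ i, ?_⟩
  · exact neg_nonpos.2 (div_nonneg (hnonneg _) (hne j).le)
  · exact neg_neg_of_pos (div_pos (hpos _ hi) (hne i))

end TraceSquare

/-! ### Negative definiteness of the Killing form of the derivation algebra. -/

namespace Octonion

theorem trace_derivation_mul_self_neg {D : Der} (hD : D ≠ 0) :
    LinearMap.trace ℝ Octonion (D.1 * D.1) < 0 :=
  trace_mul_self_neg_of_skew innerForm innerForm_comm (fun _ => innerForm_self_pos)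
    (mem_so_iff.1 (derivation_mem_so D)) fun h => hD (Subtype.ext h)

theorem der_lie_apply (D E : Der) (x : Octonion) : ⁅D, E⁆.1 x = D.1 (E.1 x) - E.1 (D.1 x) := rfl

/-- Commuting with the two torus generators kills the twelve root coordinates. Commuting with one
vector from each of the first two root planes then kills the torus coordinates. -/
theorem derivation_eq_zero_of_central {D : Der} (h : ∀ E : Der, ⁅D, E⁆ = 0) : D = 0 := by
  obtain ⟨p, rfl⟩ := derOf_surjective D
  have key : ∀ q x, derFun p (derFun q x) = derFun q (derFun p x) := fun q x => by
    have hx : ⁅derOf p, derOf q⁆.1 x = 0 := by rw [h]; rfl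
    rw [der_lie_apply, sub_eq_zero] at hx
    exact hx
  have hP1 := key ![0, 0, 0, 0, 0, 0, 0, 0, 0, 0, 0, 0, 1, 0] (unit 1)
  have hP6 := key ![0, 0, 0, 0, 0, 0, 0, 0, 0, 0, 0, 0, 1, 0] (unit 6)
  have hQ1 := key ![0, 0, 0, 0, 0, 0, 0, 0, 0, 0, 0, 0, 0, 1] (unit 1)
  have hQ4 := key ![0, 0, 0, 0, 0, 0, 0, 0, 0, 0, 0, 0, 0, 1] (unit 4)
  have hX1 := key ![1, 0, 0, 0, 0, 0, 0, 0, 0, 0, 0, 0, 0, 0] (unit 1)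
  have hX4 := key ![0, 0, 1, 0, 0, 0, 0, 0, 0, 0, 0, 0, 0, 0] (unit 4)
  have c0 := congrArg (fun z => z.fst.imJ) hP1
  have c1 := congrArg (fun z => z.fst.imK) hP1
  have c2 := congrArg (fun z => z.snd.re) hP1
  have c3 := congrArg (fun z => z.snd.imI) hP1
  have c4 := congrArg (fun z => z.snd.imJ) hQ1
  have c5 := congrArg (fun z => z.snd.imK) hQ1
  have c6 := congrArg (fun z => z.fst.imJ) hP6
  have c7 := congrArg (fun z => z.fst.imK) hP6
  have c8 := congrArg (fun z => z.fst.imJ) hQ4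
  have c9 := congrArg (fun z => z.fst.imK) hQ4
  have c10 := congrArg (fun z => z.snd.imJ) hQ4
  have c11 := congrArg (fun z => z.snd.imK) hQ4
  have c12 := congrArg (fun z => z.snd.re) hX1
  have c13 := congrArg (fun z => z.snd.imK) hX4
  simp [derFun, unit] at c0 c1 c2 c3 c4 c5 c6 c7 c8 c9 c10 c11 c12 c13
  have hp : p = 0 := by
    ext i
    fin_cases i <;> simp <;> linarith
  rw [hp, map_zero]

theorem killingForm_der_neg (D : Der) (hD : D ≠ 0) : killingForm ℝ Der D D < 0 := by
  -- The negated trace form of the action on $\mathbb{O}$ is an invariant inner product, so `ad D`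
  -- is skew for it. The Killing form at `D` is the trace of the square of this skew map.
  let τ : LinearMap.BilinForm ℝ Der := -LieModule.traceForm ℝ Der Octonion
  have hτ : ∀ D E : Der, τ D E = -LinearMap.trace ℝ Octonion (D.1 * E.1) := fun D E => rfl
  refine trace_mul_self_neg_of_skew τ (fun D E => ?_) (fun D hD => ?_) (T := LieAlgebra.ad ℝ Der D)
    (fun E F => ?_) (fun h => hD ?_)
  · rw [hτ, hτ, LinearMap.trace_mul_comm]
  · rw [hτ]
    exact neg_pos.2 (trace_derivation_mul_self_neg hD)
  · have := LieModule.traceForm_apply_lie_apply ℝ Der Octonion E D F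
    simp only [LieAlgebra.ad_apply, τ, LinearMap.neg_apply, ← this, ← lie_skew D E, map_neg]
  · exact derivation_eq_zero_of_central fun E => LinearMap.congr_fun h E

end Octonion

/-! ### The Lie algebra of a Cartan matrix -/

/-- The projection of the free Lie algebra onto the Lie algebra of a Cartan matrix. -/
def Matrix.ToLieAlgebra.mkHom {B : Type*} [DecidableEq B] (A : Matrix B B ℤ) :
    FreeLieAlgebra ℂ (CartanMatrix.Generators B) →ₗ⁅ℂ⁆ A.ToLieAlgebra ℂ where
  toFun x := (LieSubmodule.Quotient.mk x : _ ⧸ CartanMatrix.Relations.toIdeal ℂ A)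
  map_add' _ _ := rfl
  map_smul' _ _ := rfl
  map_lie' := rfl

namespace Matrix.ToLieAlgebra
variable {B : Type*} [DecidableEq B] (A : Matrix B B ℤ)

theorem mkHom_surjective : Function.Surjective (mkHom A) :=
  fun x => LieSubmodule.Quotient.surjective_mk' (CartanMatrix.Relations.toIdeal ℂ A) x

theorem mkHom_eq_zero {x : FreeLieAlgebra ℂ (CartanMatrix.Generators B)} :
    mkHom A x = 0 ↔ x ∈ CartanMatrix.Relations.toIdeal ℂ A :=
  LieSubmodule.Quotient.mk_eq_zero (N := CartanMatrix.Relations.toIdeal ℂ A)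

theorem mkHom_eq_zero_of_mem {x : FreeLieAlgebra ℂ (CartanMatrix.Generators B)}
    (hx : x ∈ CartanMatrix.Relations.toSet ℂ A) : mkHom A x = 0 :=
  (mkHom_eq_zero A).2 (LieSubmodule.subset_lieSpan hx)

/-- Lifting the generators to `K` and including back agrees with the projection `mkHom` on
generators, hence everywhere. So every element of the quotient lies in `K`. -/
theorem eq_top_of_generators_mem (K : LieSubalgebra ℂ (A.ToLieAlgebra ℂ))
    (hK : ∀ g, mkHom A (FreeLieAlgebra.of ℂ g) ∈ K) : K = ⊤ := by
  rw [eq_top_iff]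
  intro x _
  obtain ⟨y, rfl⟩ := mkHom_surjective A x
  have h : K.incl.comp (FreeLieAlgebra.lift ℂ fun g => (⟨_, hK g⟩ : K)) = mkHom A :=
    FreeLieAlgebra.hom_ext fun g => by
      rw [LieHom.comp_apply, FreeLieAlgebra.lift_of_apply]
      rfl
  rw [← h]
  exact Subtype.prop _

/-- The map out of the Lie algebra of a Cartan matrix induced by a map of the free Lie algebra
that kills the Serre relations. -/
theorem exists_lift {L : Type*} [LieRing L] [LieAlgebra ℂ L]
    (φ : FreeLieAlgebra ℂ (CartanMatrix.Generators B) →ₗ⁅ℂ⁆ L) (hφ : ∀ x ∈ CartanMatrix.Relations.toSet ℂ A, φ x = 0) :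
    ∃ ψ : A.ToLieAlgebra ℂ →ₗ⁅ℂ⁆ L, ∀ x, ψ (mkHom A x) = φ x := by
  have hle : CartanMatrix.Relations.toIdeal ℂ A ≤ φ.ker :=
    LieSubmodule.lieSpan_le.2 fun x hx => by
      rw [SetLike.mem_coe, LieHom.mem_ker]
      exact hφ x hx
  let ψ : A.ToLieAlgebra ℂ →ₗ[ℂ] L :=
    Submodule.liftQ (CartanMatrix.Relations.toIdeal ℂ A).toSubmodule (φ : _ →ₗ[ℂ] L)
      fun x hx => LinearMap.mem_ker.2 (LieHom.mem_ker.1 (hle hx))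
  have hψ : ∀ x, ψ (mkHom A x) = φ x := fun x => rfl
  refine ⟨{ ψ with map_lie' := fun {x y} => ?_ }, hψ⟩
  obtain ⟨x, rfl⟩ := mkHom_surjective A x
  obtain ⟨y, rfl⟩ := mkHom_surjective A y
  change ψ ⁅mkHom A x, mkHom A y⁆ = ⁅ψ _, ψ _⁆
  rw [← LieHom.map_lie, hψ, hψ, hψ, LieHom.map_lie]

end Matrix.ToLieAlgebra

/-! ### The Serre relations of type `G₂` -/

section G2Relations

variable {L : Type*} [LieRing L]

/-- The Serre relations for the Cartan matrix of type `G₂`, the first simple root being short. -/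
structure IsG2System (h₁ h₂ e₁ e₂ f₁ f₂ : L) : Prop where
  lie_h₁_h₂ : ⁅h₁, h₂⁆ = 0
  lie_e₁_f₁ : ⁅e₁, f₁⁆ = h₁
  lie_e₂_f₂ : ⁅e₂, f₂⁆ = h₂
  lie_e₁_f₂ : ⁅e₁, f₂⁆ = 0
  lie_e₂_f₁ : ⁅e₂, f₁⁆ = 0
  lie_h₁_e₁ : ⁅h₁, e₁⁆ = 2 • e₁
  lie_h₁_e₂ : ⁅h₁, e₂⁆ = -(3 • e₂)
  lie_h₂_e₁ : ⁅h₂, e₁⁆ = -e₁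
  lie_h₂_e₂ : ⁅h₂, e₂⁆ = 2 • e₂
  lie_h₁_f₁ : ⁅h₁, f₁⁆ = -(2 • f₁)
  lie_h₁_f₂ : ⁅h₁, f₂⁆ = 3 • f₂
  lie_h₂_f₁ : ⁅h₂, f₁⁆ = f₁
  lie_h₂_f₂ : ⁅h₂, f₂⁆ = -(2 • f₂)
  ad_e₁ : ⁅e₁, ⁅e₁, ⁅e₁, ⁅e₁, e₂⁆⁆⁆⁆ = 0
  ad_e₂ : ⁅e₂, ⁅e₂, e₁⁆⁆ = 0
  ad_f₁ : ⁅f₁, ⁅f₁, ⁅f₁, ⁅f₁, f₂⁆⁆⁆⁆ = 0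
  ad_f₂ : ⁅f₂, ⁅f₂, f₁⁆⁆ = 0

namespace IsG2System

variable {h₁ h₂ e₁ e₂ f₁ f₂ : L}

/-- This is the Chevalley involution. It transfers every computation with the positive root vectors
to the negative ones. -/
theorem symm (t : IsG2System h₁ h₂ e₁ e₂ f₁ f₂) : IsG2System (-h₁) (-h₂) f₁ f₂ e₁ e₂ where
  lie_h₁_h₂ := by simp [t.lie_h₁_h₂]
  lie_e₁_f₁ := by rw [← lie_skew, t.lie_e₁_f₁]
  lie_e₂_f₂ := by rw [← lie_skew, t.lie_e₂_f₂]
  lie_e₁_f₂ := by rw [← lie_skew, t.lie_e₂_f₁, neg_zero]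
  lie_e₂_f₁ := by rw [← lie_skew, t.lie_e₁_f₂, neg_zero]
  lie_h₁_e₁ := by rw [neg_lie, t.lie_h₁_f₁, neg_neg]
  lie_h₁_e₂ := by rw [neg_lie, t.lie_h₁_f₂]
  lie_h₂_e₁ := by rw [neg_lie, t.lie_h₂_f₁]
  lie_h₂_e₂ := by rw [neg_lie, t.lie_h₂_f₂, neg_neg]
  lie_h₁_f₁ := by rw [neg_lie, t.lie_h₁_e₁]
  lie_h₁_f₂ := by rw [neg_lie, t.lie_h₁_e₂, neg_neg]
  lie_h₂_f₁ := by rw [neg_lie, t.lie_h₂_e₁, neg_neg]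
  lie_h₂_f₂ := by rw [neg_lie, t.lie_h₂_e₂]
  ad_e₁ := t.ad_f₁
  ad_e₂ := t.ad_f₂
  ad_f₁ := t.ad_e₁
  ad_f₂ := t.ad_e₂

/-- The positive root vectors of a `G₂` system. -/
def posVec (e₁ e₂ : L) : Fin 6 → L :=
  ![e₁, e₂, ⁅e₁, e₂⁆, ⁅e₁, ⁅e₁, e₂⁆⁆, ⁅e₁, ⁅e₁, ⁅e₁, e₂⁆⁆⁆, ⁅e₂, ⁅e₁, ⁅e₁, ⁅e₁, e₂⁆⁆⁆⁆]

section Raising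

theorem lie_e₂_e₃ (t : IsG2System h₁ h₂ e₁ e₂ f₁ f₂) : ⁅e₂, ⁅e₁, e₂⁆⁆ = 0 := by
  rw [← lie_skew e₁ e₂, lie_neg, t.ad_e₂, neg_zero]

theorem lie_e₂_e₄ (t : IsG2System h₁ h₂ e₁ e₂ f₁ f₂) : ⁅e₂, ⁅e₁, ⁅e₁, e₂⁆⁆⁆ = 0 := by
  rw [leibniz_lie, t.lie_e₂_e₃, ← lie_skew e₂ e₁, neg_lie, lie_self]
  simp

theorem lie_e₃_e₄ (t : IsG2System h₁ h₂ e₁ e₂ f₁ f₂) :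
    ⁅⁅e₁, e₂⁆, ⁅e₁, ⁅e₁, e₂⁆⁆⁆ = -⁅e₂, ⁅e₁, ⁅e₁, ⁅e₁, e₂⁆⁆⁆⁆ := by
  rw [lie_lie, t.lie_e₂_e₄, lie_zero, zero_sub]

/-- Write $e_3,\dots,e_6$ for the later entries of `posVec`. The Jacobi identity gives
$[e_1,e_6]=[e_3,e_5]$, while applying $\mathrm{ad}\,e_1$ to $[e_3,e_4]=-e_6$ gives
$[e_3,e_5]=-[e_1,e_6]$. The bracket thus equals its own negative, and scalars allow division by 2.
-/
theorem lie_e₁_e₆ [LieAlgebra ℂ L] (t : IsG2System h₁ h₂ e₁ e₂ f₁ f₂) :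
    ⁅e₁, ⁅e₂, ⁅e₁, ⁅e₁, ⁅e₁, e₂⁆⁆⁆⁆⁆ = 0 := by
  have h1 : ⁅e₁, ⁅e₂, ⁅e₁, ⁅e₁, ⁅e₁, e₂⁆⁆⁆⁆⁆ = ⁅⁅e₁, e₂⁆, ⁅e₁, ⁅e₁, ⁅e₁, e₂⁆⁆⁆⁆ := by
    rw [leibniz_lie, t.ad_e₁, lie_zero, add_zero]
  have h2 : ⁅e₁, ⁅⁅e₁, e₂⁆, ⁅e₁, ⁅e₁, e₂⁆⁆⁆⁆ = ⁅⁅e₁, e₂⁆, ⁅e₁, ⁅e₁, ⁅e₁, e₂⁆⁆⁆⁆ := by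
    rw [leibniz_lie, lie_self, zero_add]
  rw [t.lie_e₃_e₄, lie_neg, h1] at h2
  rw [h1]
  have h3 := add_eq_zero_iff_eq_neg.2 h2.symm
  rw [← two_smul ℂ] at h3
  exact (smul_eq_zero.1 h3).resolve_left two_ne_zero

/-- The last root vector is $-[e_3,e_4]$, and $\mathrm{ad}\,e_2$ kills both factors. -/
theorem lie_e₂_e₆ (t : IsG2System h₁ h₂ e₁ e₂ f₁ f₂) : ⁅e₂, ⁅e₂, ⁅e₁, ⁅e₁, ⁅e₁, e₂⁆⁆⁆⁆⁆ = 0 := by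
  have h := t.lie_e₃_e₄
  rw [eq_comm, neg_eq_iff_eq_neg] at h
  rw [h, lie_neg, leibniz_lie, t.lie_e₂_e₃, t.lie_e₂_e₄, zero_lie, lie_zero, add_zero, neg_zero]

theorem lie_f₁_e₁ (t : IsG2System h₁ h₂ e₁ e₂ f₁ f₂) :
    ⁅f₁, e₁⁆ = -h₁ := by rw [← lie_skew, t.lie_e₁_f₁]

theorem lie_f₂_e₁ (t : IsG2System h₁ h₂ e₁ e₂ f₁ f₂) :
    ⁅f₂, e₁⁆ = 0 := by rw [← lie_skew, t.lie_e₁_f₂, neg_zero]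

theorem lie_f₁_e₂ (t : IsG2System h₁ h₂ e₁ e₂ f₁ f₂) :
    ⁅f₁, e₂⁆ = 0 := by rw [← lie_skew, t.lie_e₂_f₁, neg_zero]

theorem lie_f₂_e₂ (t : IsG2System h₁ h₂ e₁ e₂ f₁ f₂) :
    ⁅f₂, e₂⁆ = -h₂ := by rw [← lie_skew, t.lie_e₂_f₂]

theorem lie_h₁_e₃ (t : IsG2System h₁ h₂ e₁ e₂ f₁ f₂) : ⁅h₁, ⁅e₁, e₂⁆⁆ = -⁅e₁, e₂⁆ := by
  rw [leibniz_lie, t.lie_h₁_e₁, t.lie_h₁_e₂, nsmul_lie, lie_neg, lie_nsmul]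
  module

theorem lie_h₁_e₄ (t : IsG2System h₁ h₂ e₁ e₂ f₁ f₂) : ⁅h₁, ⁅e₁, ⁅e₁, e₂⁆⁆⁆ = ⁅e₁, ⁅e₁, e₂⁆⁆ := by
  rw [leibniz_lie, t.lie_h₁_e₁, t.lie_h₁_e₃, nsmul_lie, lie_neg]
  module

theorem lie_h₂_e₃ (t : IsG2System h₁ h₂ e₁ e₂ f₁ f₂) : ⁅h₂, ⁅e₁, e₂⁆⁆ = ⁅e₁, e₂⁆ := by
  rw [leibniz_lie, t.lie_h₂_e₁, t.lie_h₂_e₂, neg_lie, lie_nsmul]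
  module

theorem lie_h₂_e₄ (t : IsG2System h₁ h₂ e₁ e₂ f₁ f₂) : ⁅h₂, ⁅e₁, ⁅e₁, e₂⁆⁆⁆ = 0 := by
  rw [leibniz_lie, t.lie_h₂_e₁, t.lie_h₂_e₃, neg_lie]
  module

theorem lie_h₂_e₅ (t : IsG2System h₁ h₂ e₁ e₂ f₁ f₂) :
    ⁅h₂, ⁅e₁, ⁅e₁, ⁅e₁, e₂⁆⁆⁆⁆ = -⁅e₁, ⁅e₁, ⁅e₁, e₂⁆⁆⁆ := by
  rw [leibniz_lie, t.lie_h₂_e₁, t.lie_h₂_e₄, neg_lie, lie_zero, add_zero]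

theorem lie_f₁_e₃ (t : IsG2System h₁ h₂ e₁ e₂ f₁ f₂) : ⁅f₁, ⁅e₁, e₂⁆⁆ = 3 • e₂ := by
  rw [leibniz_lie, t.lie_f₁_e₁, t.lie_f₁_e₂, neg_lie, t.lie_h₁_e₂, lie_zero, add_zero, neg_neg]

theorem lie_f₁_e₄ (t : IsG2System h₁ h₂ e₁ e₂ f₁ f₂) : ⁅f₁, ⁅e₁, ⁅e₁, e₂⁆⁆⁆ = 4 • ⁅e₁, e₂⁆ := by
  rw [leibniz_lie, t.lie_f₁_e₁, t.lie_f₁_e₃, neg_lie, t.lie_h₁_e₃, lie_nsmul]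
  module

theorem lie_f₁_e₅ (t : IsG2System h₁ h₂ e₁ e₂ f₁ f₂) :
    ⁅f₁, ⁅e₁, ⁅e₁, ⁅e₁, e₂⁆⁆⁆⁆ = 3 • ⁅e₁, ⁅e₁, e₂⁆⁆ := by
  rw [leibniz_lie, t.lie_f₁_e₁, t.lie_f₁_e₄, neg_lie, t.lie_h₁_e₄, lie_nsmul]
  module

theorem lie_f₁_e₆ (t : IsG2System h₁ h₂ e₁ e₂ f₁ f₂) : ⁅f₁, ⁅e₂, ⁅e₁, ⁅e₁, ⁅e₁, e₂⁆⁆⁆⁆⁆ = 0 := by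
  rw [leibniz_lie, t.lie_f₁_e₂, t.lie_f₁_e₅, zero_lie, lie_nsmul, t.lie_e₂_e₄]
  simp

theorem lie_f₂_e₃ (t : IsG2System h₁ h₂ e₁ e₂ f₁ f₂) : ⁅f₂, ⁅e₁, e₂⁆⁆ = -e₁ := by
  rw [leibniz_lie, t.lie_f₂_e₁, t.lie_f₂_e₂, zero_lie, lie_neg, lie_skew, t.lie_h₂_e₁, zero_add]

theorem lie_f₂_e₄ (t : IsG2System h₁ h₂ e₁ e₂ f₁ f₂) : ⁅f₂, ⁅e₁, ⁅e₁, e₂⁆⁆⁆ = 0 := by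
  rw [leibniz_lie, t.lie_f₂_e₁, t.lie_f₂_e₃, zero_lie, lie_neg, lie_self]
  simp

theorem lie_f₂_e₅ (t : IsG2System h₁ h₂ e₁ e₂ f₁ f₂) : ⁅f₂, ⁅e₁, ⁅e₁, ⁅e₁, e₂⁆⁆⁆⁆ = 0 := by
  rw [leibniz_lie, t.lie_f₂_e₁, t.lie_f₂_e₄, zero_lie, lie_zero, add_zero]

theorem lie_f₂_e₆ (t : IsG2System h₁ h₂ e₁ e₂ f₁ f₂) :
    ⁅f₂, ⁅e₂, ⁅e₁, ⁅e₁, ⁅e₁, e₂⁆⁆⁆⁆⁆ = ⁅e₁, ⁅e₁, ⁅e₁, e₂⁆⁆⁆ := by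
  rw [leibniz_lie, t.lie_f₂_e₂, t.lie_f₂_e₅, neg_lie, t.lie_h₂_e₅, lie_zero, add_zero, neg_neg]

/-- This is half of the stability of the root span, stated for an arbitrary submodule `S` so that it
also applies to the system given by `symm`. -/
theorem lie_posVec_mem [LieAlgebra ℂ L] (t : IsG2System h₁ h₂ e₁ e₂ f₁ f₂) {S : Submodule ℂ L}
    (hh₁ : h₁ ∈ S) (hh₂ : h₂ ∈ S) (he : ∀ i, posVec e₁ e₂ i ∈ S) (i : Fin 6) :
    ⁅e₁, posVec e₁ e₂ i⁆ ∈ S ∧ ⁅e₂, posVec e₁ e₂ i⁆ ∈ S ∧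
    ⁅f₁, posVec e₁ e₂ i⁆ ∈ S ∧ ⁅f₂, posVec e₁ e₂ i⁆ ∈ S := by
  have m1 : e₁ ∈ S := he 0
  have m2 : e₂ ∈ S := he 1
  have m3 : ⁅e₁, e₂⁆ ∈ S := he 2
  have m4 : ⁅e₁, ⁅e₁, e₂⁆⁆ ∈ S := he 3
  have m5 : ⁅e₁, ⁅e₁, ⁅e₁, e₂⁆⁆⁆ ∈ S := he 4
  have m6 : ⁅e₂, ⁅e₁, ⁅e₁, ⁅e₁, e₂⁆⁆⁆⁆ ∈ S := he 5
  fin_cases i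
  · change ⁅e₁, e₁⁆ ∈ S ∧ ⁅e₂, e₁⁆ ∈ S ∧ ⁅f₁, e₁⁆ ∈ S ∧ ⁅f₂, e₁⁆ ∈ S
    rw [lie_self, ← lie_skew, t.lie_f₁_e₁, t.lie_f₂_e₁]
    exact ⟨zero_mem _, neg_mem m3, neg_mem hh₁, zero_mem _⟩
  · change ⁅e₁, e₂⁆ ∈ S ∧ ⁅e₂, e₂⁆ ∈ S ∧ ⁅f₁, e₂⁆ ∈ S ∧ ⁅f₂, e₂⁆ ∈ S
    rw [lie_self, t.lie_f₁_e₂, t.lie_f₂_e₂]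
    exact ⟨m3, zero_mem _, zero_mem _, neg_mem hh₂⟩
  · refine ⟨m4, t.lie_e₂_e₃ ▸ zero_mem _, t.lie_f₁_e₃ ▸ nsmul_mem m2 3, t.lie_f₂_e₃ ▸ neg_mem m1⟩
  · refine ⟨m5, t.lie_e₂_e₄ ▸ zero_mem _, t.lie_f₁_e₄ ▸ nsmul_mem m3 4, t.lie_f₂_e₄ ▸ zero_mem _⟩
  · refine ⟨t.ad_e₁ ▸ zero_mem _, m6, t.lie_f₁_e₅ ▸ nsmul_mem m4 3, t.lie_f₂_e₅ ▸ zero_mem _⟩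
  · refine ⟨t.lie_e₁_e₆ ▸ zero_mem _, t.lie_e₂_e₆ ▸ zero_mem _, t.lie_f₁_e₆ ▸ zero_mem _,
      t.lie_f₂_e₆ ▸ m5⟩

end Raising

variable [LieAlgebra ℂ L]

/-- The span of the root vectors and the coroots of a `G₂` system. -/
def rootSpan (h₁ h₂ e₁ e₂ f₁ f₂ : L) : Submodule ℂ L :=
  Submodule.span ℂ
    (Set.range (posVec e₁ e₂) ∪ Set.range (posVec f₁ f₂) ∪ Set.range ![h₁, h₂])

theorem finrank_rootSpan_le (h₁ h₂ e₁ e₂ f₁ f₂ : L) :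
    Module.finrank ℂ (rootSpan h₁ h₂ e₁ e₂ f₁ f₂) ≤ 14 := by
  classical
  have h : (Set.range (posVec e₁ e₂) ∪ Set.range (posVec f₁ f₂) ∪ Set.range ![h₁, h₂]) =
      ((Finset.univ.image (posVec e₁ e₂) ∪ Finset.univ.image (posVec f₁ f₂) ∪
        Finset.univ.image ![h₁, h₂] : Finset L) : Set L) := by simp
  rw [rootSpan, h]
  refine (finrank_span_finset_le_card _).trans ?_
  refine (Finset.card_union_le _ _).trans ?_
  have h1 := Finset.card_union_le (Finset.univ.image (posVec e₁ e₂))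
    (Finset.univ.image (posVec f₁ f₂))
  have h2 := Finset.card_image_le (s := Finset.univ) (f := posVec e₁ e₂)
  have h3 := Finset.card_image_le (s := Finset.univ) (f := posVec f₁ f₂)
  have h4 := Finset.card_image_le (s := Finset.univ) (f := ![h₁, h₂])
  simp only [Finset.card_univ, Fintype.card_fin] at h2 h3 h4
  omega

instance (h₁ h₂ e₁ e₂ f₁ f₂ : L) : FiniteDimensional ℂ (rootSpan h₁ h₂ e₁ e₂ f₁ f₂) :=
  FiniteDimensional.span_of_finite ℂ
    (((Set.finite_range _).union (Set.finite_range _)).union (Set.finite_range _))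

theorem lie_mem_rootSpan (t : IsG2System h₁ h₂ e₁ e₂ f₁ f₂) {y : L}
    (hy : y ∈ rootSpan h₁ h₂ e₁ e₂ f₁ f₂) :
    ⁅e₁, y⁆ ∈ rootSpan h₁ h₂ e₁ e₂ f₁ f₂ ∧ ⁅e₂, y⁆ ∈ rootSpan h₁ h₂ e₁ e₂ f₁ f₂ ∧
    ⁅f₁, y⁆ ∈ rootSpan h₁ h₂ e₁ e₂ f₁ f₂ ∧ ⁅f₂, y⁆ ∈ rootSpan h₁ h₂ e₁ e₂ f₁ f₂ := by
  have he : ∀ i, posVec e₁ e₂ i ∈ rootSpan h₁ h₂ e₁ e₂ f₁ f₂ := fun i =>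
    Submodule.subset_span (Or.inl (Or.inl ⟨i, rfl⟩))
  have hf : ∀ i, posVec f₁ f₂ i ∈ rootSpan h₁ h₂ e₁ e₂ f₁ f₂ := fun i =>
    Submodule.subset_span (Or.inl (Or.inr ⟨i, rfl⟩))
  have hh₁ : h₁ ∈ rootSpan h₁ h₂ e₁ e₂ f₁ f₂ := Submodule.subset_span (Or.inr ⟨0, rfl⟩)
  have hh₂ : h₂ ∈ rootSpan h₁ h₂ e₁ e₂ f₁ f₂ := Submodule.subset_span (Or.inr ⟨1, rfl⟩)
  have m1 := he 0
  have m2 := he 1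
  have n1 := hf 0
  have n2 := hf 1
  induction hy using Submodule.span_induction with
  | mem x hx =>
    obtain (⟨i, rfl⟩ | ⟨i, rfl⟩) | ⟨i, rfl⟩ := hx
    · exact t.lie_posVec_mem hh₁ hh₂ he i
    · obtain ⟨a, b, c, d⟩ := t.symm.lie_posVec_mem (neg_mem hh₁) (neg_mem hh₂) hf i
      exact ⟨c, d, a, b⟩
    · fin_cases i
      · change ⁅e₁, h₁⁆ ∈ _ ∧ ⁅e₂, h₁⁆ ∈ _ ∧ ⁅f₁, h₁⁆ ∈ _ ∧ ⁅f₂, h₁⁆ ∈ _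
        rw [← lie_skew e₁, ← lie_skew e₂, ← lie_skew f₁, ← lie_skew f₂, t.lie_h₁_e₁, t.lie_h₁_e₂,
          t.lie_h₁_f₁, t.lie_h₁_f₂, neg_neg, neg_neg]
        exact ⟨neg_mem (nsmul_mem m1 2), nsmul_mem m2 3, nsmul_mem n1 2, neg_mem (nsmul_mem n2 3)⟩
      · change ⁅e₁, h₂⁆ ∈ _ ∧ ⁅e₂, h₂⁆ ∈ _ ∧ ⁅f₁, h₂⁆ ∈ _ ∧ ⁅f₂, h₂⁆ ∈ _
        rw [← lie_skew e₁, ← lie_skew e₂, ← lie_skew f₁, ← lie_skew f₂, t.lie_h₂_e₁, t.lie_h₂_e₂,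
          t.lie_h₂_f₁, t.lie_h₂_f₂, neg_neg, neg_neg]
        exact ⟨m1, neg_mem (nsmul_mem m2 2), neg_mem n1, nsmul_mem n2 2⟩
  | zero => simp
  | add x y _ _ hx hy =>
    simp only [lie_add]
    exact ⟨add_mem hx.1 hy.1, add_mem hx.2.1 hy.2.1, add_mem hx.2.2.1 hy.2.2.1,
      add_mem hx.2.2.2 hy.2.2.2⟩
  | smul r x _ hx =>
    simp only [lie_smul]
    exact ⟨Submodule.smul_mem _ r hx.1, Submodule.smul_mem _ r hx.2.1,
      Submodule.smul_mem _ r hx.2.2.1, Submodule.smul_mem _ r hx.2.2.2⟩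

/-- The elements whose adjoint action preserves the span form a subalgebra containing the
generators, hence all of `L`. The span is therefore a subalgebra, and it too contains the
generators. -/
theorem rootSpan_eq_top (t : IsG2System h₁ h₂ e₁ e₂ f₁ f₂)
    (hgen : ∀ K : LieSubalgebra ℂ L, e₁ ∈ K → e₂ ∈ K → f₁ ∈ K → f₂ ∈ K → K = ⊤) :
    rootSpan h₁ h₂ e₁ e₂ f₁ f₂ = ⊤ := by
  let N : LieSubalgebra ℂ L :=
    { carrier := {x | ∀ y ∈ rootSpan h₁ h₂ e₁ e₂ f₁ f₂, ⁅x, y⁆ ∈ rootSpan h₁ h₂ e₁ e₂ f₁ f₂}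
      add_mem' := fun {a b} ha hb y hy => by
        rw [add_lie]
        exact add_mem (ha y hy) (hb y hy)
      zero_mem' := fun y _ => by
        rw [zero_lie]
        exact zero_mem _
      smul_mem' := fun r x hx y hy => by
        rw [smul_lie]
        exact Submodule.smul_mem _ r (hx y hy)
      lie_mem' := fun {a b} ha hb y hy => by
        rw [lie_lie]
        exact sub_mem (ha _ (hb y hy)) (hb _ (ha y hy)) }
  have hN : N = ⊤ := hgen N (fun y hy => (t.lie_mem_rootSpan hy).1)
    (fun y hy => (t.lie_mem_rootSpan hy).2.1) (fun y hy => (t.lie_mem_rootSpan hy).2.2.1)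
    fun y hy => (t.lie_mem_rootSpan hy).2.2.2
  let S : LieSubalgebra ℂ L :=
    { rootSpan h₁ h₂ e₁ e₂ f₁ f₂ with
      lie_mem' := fun {a b} _ hb => by
        have ha : a ∈ N := hN ▸ LieSubalgebra.mem_top a
        exact ha b hb }
  have hS : S = ⊤ := hgen S (Submodule.subset_span (Or.inl (Or.inl ⟨0, rfl⟩)))
    (Submodule.subset_span (Or.inl (Or.inl ⟨1, rfl⟩)))
    (Submodule.subset_span (Or.inl (Or.inr ⟨0, rfl⟩)))
    (Submodule.subset_span (Or.inl (Or.inr ⟨1, rfl⟩)))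
  rw [eq_top_iff]
  intro x _
  have hx : x ∈ S := hS ▸ LieSubalgebra.mem_top x
  exact hx

end IsG2System

end G2Relations

/-! ### The dimension of the Lie algebra of type `G₂` -/

section SerreG2

open CartanMatrix Matrix.ToLieAlgebra

/-- The Serre generators of the Lie algebra of type `G₂`. -/
def g2Gen (g : Generators (Fin 2)) : LieAlgebra.g₂ ℂ := mkHom G₂ (FreeLieAlgebra.of ℂ g)

theorem g2Gen_isG2System : IsG2System (g2Gen (.H 0)) (g2Gen (.H 1)) (g2Gen (.E 0)) (g2Gen (.E 1))
    (g2Gen (.F 0)) (g2Gen (.F 1)) := by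
  have mem : ∀ x ∈ Relations.toSet ℂ G₂, mkHom G₂ x = 0 := fun x => mkHom_eq_zero_of_mem G₂
  have hHH : ∀ i j, ⁅g2Gen (.H i), g2Gen (.H j)⁆ = 0 := fun i j => by
    rw [← mem (Relations.HH ℂ (i, j)) (by simp [Relations.toSet])]
    simp [Relations.HH, g2Gen]
  have hEF : ∀ i, ⁅g2Gen (.E i), g2Gen (.F i)⁆ = g2Gen (.H i) := fun i => by
    rw [← sub_eq_zero, ← mem (Relations.EF ℂ (i, i)) (by simp [Relations.toSet])]
    simp [Relations.EF, g2Gen]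
  have hEF' : ∀ i j, i ≠ j → ⁅g2Gen (.E i), g2Gen (.F j)⁆ = 0 := fun i j hij => by
    rw [← mem (Relations.EF ℂ (i, j)) (by simp [Relations.toSet])]
    simp [Relations.EF, g2Gen, hij]
  have hHE : ∀ i j, ⁅g2Gen (.H i), g2Gen (.E j)⁆ = G₂ i j • g2Gen (.E j) := fun i j => by
    rw [← sub_eq_zero, ← mem (Relations.HE ℂ G₂ (i, j)) (by simp [Relations.toSet])]
    simp [Relations.HE, g2Gen]
  have hHF : ∀ i j, ⁅g2Gen (.H i), g2Gen (.F j)⁆ = -(G₂ i j • g2Gen (.F j)) := fun i j => by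
    rw [← add_eq_zero_iff_eq_neg, ← mem (Relations.HF ℂ G₂ (i, j)) (by simp [Relations.toSet])]
    simp [Relations.HF, g2Gen]
  have hadE : ∀ i j, mkHom G₂ (Relations.adE ℂ G₂ (i, j)) = 0 := fun i j =>
    mem _ (by simp [Relations.toSet])
  have hadF : ∀ i j, mkHom G₂ (Relations.adF ℂ G₂ (i, j)) = 0 := fun i j =>
    mem _ (by simp [Relations.toSet])
  -- The Serre relation applies $\mathrm{ad}(e_i)^{-A_{ij}}$ to $[e_i,e_j]$. The exponents 3 and 1
  -- therefore give nested brackets with four and two copies of $e_i$.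
  have n1 : (-G₂ 0 1).toNat = 3 := rfl
  have n2 : (-G₂ 1 0).toNat = 1 := rfl
  exact
    { lie_h₁_h₂ := hHH 0 1
      lie_e₁_f₁ := hEF 0
      lie_e₂_f₂ := hEF 1
      lie_e₁_f₂ := hEF' 0 1 (by decide)
      lie_e₂_f₁ := hEF' 1 0 (by decide)
      lie_h₁_e₁ := (hHE 0 0).trans (ofNat_zsmul _ 2)
      lie_h₁_e₂ := (hHE 0 1).trans ((neg_zsmul _ 3).trans (congrArg _ (ofNat_zsmul _ 3)))
      lie_h₂_e₁ := (hHE 1 0).trans (neg_one_zsmul _)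
      lie_h₂_e₂ := (hHE 1 1).trans (ofNat_zsmul _ 2)
      lie_h₁_f₁ := (hHF 0 0).trans (congrArg _ (ofNat_zsmul _ 2))
      lie_h₁_f₂ := by
        rw [hHF, ← neg_zsmul]
        exact ofNat_zsmul _ 3
      lie_h₂_f₁ := by
        rw [hHF, ← neg_zsmul]
        exact one_zsmul _
      lie_h₂_f₂ := (hHF 1 1).trans (congrArg _ (ofNat_zsmul _ 2))
      ad_e₁ := by
        rw [← hadE 0 1]
        simp [Relations.adE, g2Gen, n1, pow_succ]
      ad_e₂ := by
        rw [← hadE 1 0]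
        simp [Relations.adE, g2Gen, n2]
      ad_f₁ := by
        rw [← hadF 0 1]
        simp [Relations.adF, g2Gen, n1, pow_succ]
      ad_f₂ := by
        rw [← hadF 1 0]
        simp [Relations.adF, g2Gen, n2] }

theorem g2Gen_rootSpan_eq_top : IsG2System.rootSpan (g2Gen (.H 0)) (g2Gen (.H 1)) (g2Gen (.E 0))
    (g2Gen (.E 1)) (g2Gen (.F 0)) (g2Gen (.F 1)) = ⊤ := by
  have t := g2Gen_isG2System
  refine t.rootSpan_eq_top fun K h1 h2 h3 h4 => ?_
  refine eq_top_of_generators_mem G₂ K fun g => ?_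
  change g2Gen g ∈ K
  rcases g with i | i | i <;> fin_cases i
  · exact t.lie_e₁_f₁ ▸ K.lie_mem h1 h3
  · exact t.lie_e₂_f₂ ▸ K.lie_mem h2 h4
  · exact h1
  · exact h2
  · exact h3
  · exact h4

instance : FiniteDimensional ℂ (LieAlgebra.g₂ ℂ) := by
  have h : FiniteDimensional ℂ (⊤ : Submodule ℂ (LieAlgebra.g₂ ℂ)) := by
    rw [← g2Gen_rootSpan_eq_top]
    infer_instance
  exact Module.finite_def.2 (Module.Finite.iff_fg.1 h)

theorem finrank_g₂_le : Module.finrank ℂ (LieAlgebra.g₂ ℂ) ≤ 14 := by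
  rw [← finrank_top ℂ (LieAlgebra.g₂ ℂ), ← g2Gen_rootSpan_eq_top]
  exact IsG2System.finrank_rootSpan_le _ _ _ _ _ _

/-- A `G₂` system in a complex Lie algebra gives a homomorphism from the Lie algebra of type
`G₂`. -/
theorem IsG2System.exists_hom {L : Type*} [LieRing L] [LieAlgebra ℂ L] {h₁ h₂ e₁ e₂ f₁ f₂ : L}
    (t : IsG2System h₁ h₂ e₁ e₂ f₁ f₂) : ∃ ψ : LieAlgebra.g₂ ℂ →ₗ⁅ℂ⁆ L,
      h₁ ∈ ψ.range ∧ h₂ ∈ ψ.range ∧ e₁ ∈ ψ.range ∧ e₂ ∈ ψ.range ∧ f₁ ∈ ψ.range ∧ f₂ ∈ ψ.range := by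
  let v : Generators (Fin 2) → L
    | .H i => ![h₁, h₂] i
    | .E i => ![e₁, e₂] i
    | .F i => ![f₁, f₂] i
  have n1 : (-G₂ 0 1).toNat = 3 := rfl
  have n2 : (-G₂ 1 0).toNat = 1 := rfl
  have c01 : G₂ 0 1 = -3 := rfl
  have c10 : G₂ 1 0 = -1 := rfl
  obtain ⟨ψ, hψ⟩ := exists_lift G₂ (FreeLieAlgebra.lift ℂ v) fun x hx => by
    rcases hx with ((((⟨⟨i, j⟩, rfl⟩ | ⟨⟨i, j⟩, rfl⟩) | ⟨⟨i, j⟩, rfl⟩) | ⟨⟨i, j⟩, rfl⟩) |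
      ⟨⟨i, j⟩, rfl⟩) | ⟨⟨i, j⟩, rfl⟩
    · fin_cases i <;> fin_cases j <;> simp [Relations.HH, v, t.lie_h₁_h₂]
      rw [← lie_skew, t.lie_h₁_h₂, neg_zero]
    · fin_cases i <;> fin_cases j <;>
        simp [Relations.EF, v, t.lie_e₁_f₁, t.lie_e₂_f₂, t.lie_e₁_f₂, t.lie_e₂_f₁]
    · fin_cases i <;> fin_cases j <;>
        simp [Relations.HE, v, t.lie_h₁_e₁, t.lie_h₁_e₂, t.lie_h₂_e₁, t.lie_h₂_e₂, c01, c10,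
          ofNat_zsmul]
    · fin_cases i <;> fin_cases j <;>
        simp [Relations.HF, v, t.lie_h₁_f₁, t.lie_h₁_f₂, t.lie_h₂_f₁, t.lie_h₂_f₂, c01, c10,
          ofNat_zsmul]
    · fin_cases i <;> fin_cases j <;>
        simp [Relations.adE, v, n1, n2, pow_succ, t.ad_e₁, t.ad_e₂]
    · fin_cases i <;> fin_cases j <;>
        simp [Relations.adF, v, n1, n2, pow_succ, t.ad_f₁, t.ad_f₂]
  have hmem : ∀ g, v g ∈ ψ.range := fun g =>
    ⟨mkHom G₂ (FreeLieAlgebra.of ℂ g), (hψ _).trans (FreeLieAlgebra.lift_of_apply ..)⟩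
  exact ⟨ψ, hmem (.H 0), hmem (.H 1), hmem (.E 0), hmem (.E 1), hmem (.F 0), hmem (.F 1)⟩

end SerreG2

/-! ### Root vectors in the complexification of `Der 𝕆` -/

namespace Octonion

/-- The bracket of derivations in coordinates. -/
def derBracket (p q : Fin 14 → ℝ) : Fin 14 → ℝ
  | 0 =>
    -(p 1 * q 12 - p 12 * q 1) - (p 2 * q 4 - p 4 * q 2) - (p 3 * q 5 - p 5 * q 3)
      - (p 6 * q 8 - p 8 * q 6) - (p 7 * q 9 - p 9 * q 7) + 2 * (p 4 * q 6 - p 6 * q 4)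
      + 2 * (p 5 * q 7 - p 7 * q 5)
  | 1 =>
    (p 0 * q 12 - p 12 * q 0) + (p 3 * q 4 - p 4 * q 3) + (p 7 * q 8 - p 8 * q 7)
      - (p 2 * q 5 - p 5 * q 2) - (p 6 * q 9 - p 9 * q 6) + 2 * (p 4 * q 7 - p 7 * q 4)
      - 2 * (p 5 * q 6 - p 6 * q 5)
  | 2 =>
    3 * (p 0 * q 4 - p 4 * q 0) + 3 * (p 1 * q 5 - p 5 * q 1) + (p 3 * q 12 - p 12 * q 3)
      - (p 3 * q 13 - p 13 * q 3) - (p 8 * q 10 - p 10 * q 8) - (p 9 * q 11 - p 11 * q 9)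
  | 3 =>
    3 * (p 0 * q 5 - p 5 * q 0) - 3 * (p 1 * q 4 - p 4 * q 1) - (p 2 * q 12 - p 12 * q 2)
      - (p 8 * q 11 - p 11 * q 8) + (p 2 * q 13 - p 13 * q 2) + (p 9 * q 10 - p 10 * q 9)
  | 4 =>
    -(p 0 * q 2 - p 2 * q 0) - (p 5 * q 13 - p 13 * q 5) - 2 * (p 0 * q 6 - p 6 * q 0)
      - 2 * (p 1 * q 7 - p 7 * q 1) + (p 1 * q 3 - p 3 * q 1) + (p 6 * q 10 - p 10 * q 6)
      + (p 7 * q 11 - p 11 * q 7)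
  | 5 =>
    -(p 0 * q 3 - p 3 * q 0) - (p 1 * q 2 - p 2 * q 1) - (p 7 * q 10 - p 10 * q 7)
      - 2 * (p 0 * q 7 - p 7 * q 0) + 2 * (p 1 * q 6 - p 6 * q 1) + (p 4 * q 13 - p 13 * q 4)
      + (p 6 * q 11 - p 11 * q 6)
  | 6 =>
    2 * (p 0 * q 4 - p 4 * q 0) + (p 0 * q 8 - p 8 * q 0) + (p 1 * q 9 - p 9 * q 1)
      - 2 * (p 1 * q 5 - p 5 * q 1) - (p 4 * q 10 - p 10 * q 4) - (p 5 * q 11 - p 11 * q 5)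
      - (p 7 * q 12 - p 12 * q 7) - (p 7 * q 13 - p 13 * q 7)
  | 7 =>
    2 * (p 0 * q 5 - p 5 * q 0) + 2 * (p 1 * q 4 - p 4 * q 1) + (p 0 * q 9 - p 9 * q 0)
      + (p 5 * q 10 - p 10 * q 5) + (p 6 * q 12 - p 12 * q 6) + (p 6 * q 13 - p 13 * q 6)
      - (p 1 * q 8 - p 8 * q 1) - (p 4 * q 11 - p 11 * q 4)
  | 8 =>
    -3 * (p 0 * q 6 - p 6 * q 0) + 3 * (p 1 * q 7 - p 7 * q 1) + (p 2 * q 10 - p 10 * q 2)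
      + (p 3 * q 11 - p 11 * q 3) - 2 * (p 9 * q 12 - p 12 * q 9) - (p 9 * q 13 - p 13 * q 9)
  | 9 =>
    -3 * (p 0 * q 7 - p 7 * q 0) - 3 * (p 1 * q 6 - p 6 * q 1) + (p 2 * q 11 - p 11 * q 2)
      + (p 8 * q 13 - p 13 * q 8) - (p 3 * q 10 - p 10 * q 3) + 2 * (p 8 * q 12 - p 12 * q 8)
  | 10 =>
    -(p 2 * q 8 - p 8 * q 2) - (p 11 * q 12 - p 12 * q 11) + (p 3 * q 9 - p 9 * q 3)
      + 3 * (p 4 * q 6 - p 6 * q 4) - 3 * (p 5 * q 7 - p 7 * q 5)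
      - 2 * (p 11 * q 13 - p 13 * q 11)
  | 11 =>
    -(p 2 * q 9 - p 9 * q 2) - (p 3 * q 8 - p 8 * q 3) + 3 * (p 4 * q 7 - p 7 * q 4)
      + 3 * (p 5 * q 6 - p 6 * q 5) + (p 10 * q 12 - p 12 * q 10)
      + 2 * (p 10 * q 13 - p 13 * q 10)
  | 12 =>
    -4 * (p 0 * q 1 - p 1 * q 0) + 2 * (p 2 * q 3 - p 3 * q 2) + 2 * (p 4 * q 5 - p 5 * q 4)
      - 2 * (p 6 * q 7 - p 7 * q 6) - 2 * (p 8 * q 9 - p 9 * q 8)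
  | 13 =>
    2 * (p 0 * q 1 - p 1 * q 0) - 2 * (p 2 * q 3 - p 3 * q 2) - 2 * (p 6 * q 7 - p 7 * q 6)
      - 2 * (p 10 * q 11 - p 11 * q 10) - 4 * (p 4 * q 5 - p 5 * q 4)

/-- This gives the structure constants of $\mathrm{Der}(\mathbb{O})$. With `lie_derC_derC`, it
reduces every bracket identity in the complexification to arithmetic in coordinates. -/
theorem lie_derOf_derOf (p q : Fin 14 → ℝ) : ⁅derOf p, derOf q⁆ = derOf (derBracket p q) := by
  ext x : 2
  rw [der_lie_apply]
  simp only [derOf_apply]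
  apply coord_ext <;>
  simp only [derFun, derBracket, fst_sub, snd_sub, Quaternion.re_sub, Quaternion.imI_sub,
    Quaternion.imJ_sub, Quaternion.imK_sub, re_fst_ofCoords, imI_fst_ofCoords, imJ_fst_ofCoords,
    imK_fst_ofCoords, re_snd_ofCoords, imI_snd_ofCoords, imJ_snd_ofCoords, imK_snd_ofCoords] <;>
  ring

/-- The element of `ℂ ⊗ Der 𝕆` with given real and imaginary coordinates. -/
def derC (p q : Fin 14 → ℝ) : ℂ ⊗[ℝ] Der :=
  (1 : ℂ) ⊗ₜ[ℝ] derOf p + Complex.I ⊗ₜ[ℝ] derOf q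

theorem lie_derC_derC (p q r s : Fin 14 → ℝ) : ⁅derC p q, derC r s⁆ =
    derC (derBracket p r - derBracket q s) (derBracket p s + derBracket q r) := by
  simp only [derC, add_lie, lie_add, LieAlgebra.ExtendScalars.bracket_tmul, lie_derOf_derOf,
    map_add, map_sub, TensorProduct.tmul_add, TensorProduct.tmul_sub, one_mul, mul_one,
    Complex.I_mul_I, TensorProduct.neg_tmul]
  abel

theorem derC_zero : derC 0 0 = 0 := by simp [derC]

theorem neg_derC (p q : Fin 14 → ℝ) : -derC p q = derC (-p) (-q) := by
  simp [derC, TensorProduct.tmul_neg]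
  abel

theorem nsmul_derC (n : ℕ) (p q : Fin 14 → ℝ) : n • derC p q = derC (n • p) (n • q) := by
  simp only [derC, map_nsmul, nsmul_add, TensorProduct.tmul_smul]

/-- The root vector with real part `a` and imaginary part `b` times the basis elements of the
`k`-th root plane. -/
def rootVec (k : Fin 7) (a b : ℝ) : ℂ ⊗[ℝ] Der :=
  derC (Pi.single (Fin.mk (2 * k.1) (by omega)) a) (Pi.single (Fin.mk (2 * k.1 + 1) (by omega)) b)

/-- An element of the complexified maximal torus. -/
def torusVec (a b : ℝ) : ℂ ⊗[ℝ] Der := derC 0 (Pi.single 12 a + Pi.single 13 b)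

/-! ### Bracket table of the root vectors. -/

set_option linter.unusedSimpArgs false
set_option linter.unnecessarySeqFocus false
set_option linter.unusedTactic false
set_option linter.unreachableTactic false

theorem derC_congr {p q r s : Fin 14 → ℝ} (h : p = r) (h' : q = s) : derC p q = derC r s := by
  rw [h, h']

/-- With $\alpha$ the short and $\beta$ the long simple root, the planes 0 to 5 belong to $\alpha$,
$\beta$, $\alpha+\beta$, $2\alpha+\beta$, $3\alpha+\beta$, $3\alpha+2\beta$. Equal coefficients give
the positive root vector, opposite ones the negative. -/
theorem lie_e₁_e₂ : ⁅rootVec 0 1 1, rootVec 1 1 1⁆ = rootVec 2 (-2) (-2) := by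
  simp only [rootVec, Fin.isValue, Fin.coe_ofNat_eq_mod, Nat.reduceMod, Nat.reduceMul,
    Nat.reduceAdd, Fin.zero_eta, Fin.mk_one, Fin.reduceFinMk]
  rw [lie_derC_derC]
  refine derC_congr ?_ ?_ <;> ext i <;> fin_cases i <;>
    simp only [Fin.zero_eta, Fin.mk_one, Fin.reduceFinMk, Fin.isValue, Fin.reduceEq, Pi.sub_apply,
      Pi.add_apply, Pi.neg_apply, Pi.smul_apply, Pi.zero_apply, nsmul_eq_mul, derBracket,
      Pi.single_apply, if_true, if_false, mul_zero, zero_mul, sub_zero, zero_sub, add_zero,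
      zero_add, neg_zero, mul_one, one_mul] <;>
    norm_num [Pi.single_apply] <;>
    decide

theorem lie_e₁_e₃ : ⁅rootVec 0 1 1, rootVec 2 (-2) (-2)⁆ = rootVec 3 (-8) (-8) := by
  simp only [rootVec, Fin.isValue, Fin.coe_ofNat_eq_mod, Nat.reduceMod, Nat.reduceMul,
    Nat.reduceAdd, Fin.zero_eta, Fin.mk_one, Fin.reduceFinMk]
  rw [lie_derC_derC]
  refine derC_congr ?_ ?_ <;> ext i <;> fin_cases i <;>
    simp only [Fin.zero_eta, Fin.mk_one, Fin.reduceFinMk, Fin.isValue, Fin.reduceEq, Pi.sub_apply,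
      Pi.add_apply, Pi.neg_apply, Pi.smul_apply, Pi.zero_apply, nsmul_eq_mul, derBracket,
      Pi.single_apply, if_true, if_false, mul_zero, zero_mul, sub_zero, zero_sub, add_zero,
      zero_add, neg_zero, mul_one, one_mul] <;>
    norm_num [Pi.single_apply] <;>
    decide

theorem lie_e₁_e₄ : ⁅rootVec 0 1 1, rootVec 3 (-8) (-8)⁆ = rootVec 4 48 48 := by
  simp only [rootVec, Fin.isValue, Fin.coe_ofNat_eq_mod, Nat.reduceMod, Nat.reduceMul,
    Nat.reduceAdd, Fin.zero_eta, Fin.mk_one, Fin.reduceFinMk]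
  rw [lie_derC_derC]
  refine derC_congr ?_ ?_ <;> ext i <;> fin_cases i <;>
    simp only [Fin.zero_eta, Fin.mk_one, Fin.reduceFinMk, Fin.isValue, Fin.reduceEq, Pi.sub_apply,
      Pi.add_apply, Pi.neg_apply, Pi.smul_apply, Pi.zero_apply, nsmul_eq_mul, derBracket,
      Pi.single_apply, if_true, if_false, mul_zero, zero_mul, sub_zero, zero_sub, add_zero,
      zero_add, neg_zero, mul_one, one_mul] <;>
    norm_num [Pi.single_apply] <;>
    decide

theorem lie_e₂_e₅ : ⁅rootVec 1 1 1, rootVec 4 48 48⁆ = rootVec 5 (-96) (-96) := by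
  simp only [rootVec, Fin.isValue, Fin.coe_ofNat_eq_mod, Nat.reduceMod, Nat.reduceMul,
    Nat.reduceAdd, Fin.zero_eta, Fin.mk_one, Fin.reduceFinMk]
  rw [lie_derC_derC]
  refine derC_congr ?_ ?_ <;> ext i <;> fin_cases i <;>
    simp only [Fin.zero_eta, Fin.mk_one, Fin.reduceFinMk, Fin.isValue, Fin.reduceEq, Pi.sub_apply,
      Pi.add_apply, Pi.neg_apply, Pi.smul_apply, Pi.zero_apply, nsmul_eq_mul, derBracket,
      Pi.single_apply, if_true, if_false, mul_zero, zero_mul, sub_zero, zero_sub, add_zero,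
      zero_add, neg_zero, mul_one, one_mul] <;>
    norm_num [Pi.single_apply] <;>
    decide

theorem lie_f₁_f₂ : ⁅rootVec 0 (-1 / 4) (1 / 4), rootVec 1 (-1 / 4) (1 / 4)⁆ = rootVec 2 (-1 / 8) (1 / 8) := by
  simp only [rootVec, Fin.isValue, Fin.coe_ofNat_eq_mod, Nat.reduceMod, Nat.reduceMul,
    Nat.reduceAdd, Fin.zero_eta, Fin.mk_one, Fin.reduceFinMk]
  rw [lie_derC_derC]
  refine derC_congr ?_ ?_ <;> ext i <;> fin_cases i <;>
    simp only [Fin.zero_eta, Fin.mk_one, Fin.reduceFinMk, Fin.isValue, Fin.reduceEq, Pi.sub_apply,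
      Pi.add_apply, Pi.neg_apply, Pi.smul_apply, Pi.zero_apply, nsmul_eq_mul, derBracket,
      Pi.single_apply, if_true, if_false, mul_zero, zero_mul, sub_zero, zero_sub, add_zero,
      zero_add, neg_zero, mul_one, one_mul] <;>
    norm_num [Pi.single_apply] <;>
    decide

theorem lie_f₁_f₃ : ⁅rootVec 0 (-1 / 4) (1 / 4), rootVec 2 (-1 / 8) (1 / 8)⁆ = rootVec 3 (1 / 8) (-1 / 8) := by
  simp only [rootVec, Fin.isValue, Fin.coe_ofNat_eq_mod, Nat.reduceMod, Nat.reduceMul,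
    Nat.reduceAdd, Fin.zero_eta, Fin.mk_one, Fin.reduceFinMk]
  rw [lie_derC_derC]
  refine derC_congr ?_ ?_ <;> ext i <;> fin_cases i <;>
    simp only [Fin.zero_eta, Fin.mk_one, Fin.reduceFinMk, Fin.isValue, Fin.reduceEq, Pi.sub_apply,
      Pi.add_apply, Pi.neg_apply, Pi.smul_apply, Pi.zero_apply, nsmul_eq_mul, derBracket,
      Pi.single_apply, if_true, if_false, mul_zero, zero_mul, sub_zero, zero_sub, add_zero,
      zero_add, neg_zero, mul_one, one_mul] <;>
    norm_num [Pi.single_apply] <;>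
    decide

theorem lie_f₁_f₄ : ⁅rootVec 0 (-1 / 4) (1 / 4), rootVec 3 (1 / 8) (-1 / 8)⁆ = rootVec 4 (3 / 16) (-3 / 16) := by
  simp only [rootVec, Fin.isValue, Fin.coe_ofNat_eq_mod, Nat.reduceMod, Nat.reduceMul,
    Nat.reduceAdd, Fin.zero_eta, Fin.mk_one, Fin.reduceFinMk]
  rw [lie_derC_derC]
  refine derC_congr ?_ ?_ <;> ext i <;> fin_cases i <;>
    simp only [Fin.zero_eta, Fin.mk_one, Fin.reduceFinMk, Fin.isValue, Fin.reduceEq, Pi.sub_apply,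
      Pi.add_apply, Pi.neg_apply, Pi.smul_apply, Pi.zero_apply, nsmul_eq_mul, derBracket,
      Pi.single_apply, if_true, if_false, mul_zero, zero_mul, sub_zero, zero_sub, add_zero,
      zero_add, neg_zero, mul_one, one_mul] <;>
    norm_num [Pi.single_apply] <;>
    decide

theorem lie_f₂_f₅ : ⁅rootVec 1 (-1 / 4) (1 / 4), rootVec 4 (3 / 16) (-3 / 16)⁆ = rootVec 5 (3 / 32) (-3 / 32) := by
  simp only [rootVec, Fin.isValue, Fin.coe_ofNat_eq_mod, Nat.reduceMod, Nat.reduceMul,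
    Nat.reduceAdd, Fin.zero_eta, Fin.mk_one, Fin.reduceFinMk]
  rw [lie_derC_derC]
  refine derC_congr ?_ ?_ <;> ext i <;> fin_cases i <;>
    simp only [Fin.zero_eta, Fin.mk_one, Fin.reduceFinMk, Fin.isValue, Fin.reduceEq, Pi.sub_apply,
      Pi.add_apply, Pi.neg_apply, Pi.smul_apply, Pi.zero_apply, nsmul_eq_mul, derBracket,
      Pi.single_apply, if_true, if_false, mul_zero, zero_mul, sub_zero, zero_sub, add_zero,
      zero_add, neg_zero, mul_one, one_mul] <;>
    norm_num [Pi.single_apply] <;>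
    decide

theorem lie_h₁_h₂ : ⁅torusVec (-2) 1, torusVec 1 (-1)⁆ = 0 := by
  simp only [torusVec]
  rw [lie_derC_derC, ← derC_zero]
  refine derC_congr ?_ ?_ <;> ext i <;> fin_cases i <;>
    simp only [Fin.zero_eta, Fin.mk_one, Fin.reduceFinMk, Fin.isValue, Fin.reduceEq, Pi.sub_apply,
      Pi.add_apply, Pi.neg_apply, Pi.smul_apply, Pi.zero_apply, nsmul_eq_mul, derBracket,
      Pi.single_apply, if_true, if_false, mul_zero, zero_mul, sub_zero, zero_sub, add_zero,
      zero_add, neg_zero, mul_one, one_mul] <;>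
    norm_num [Pi.single_apply] <;>
    decide

/-- The factor $-1/4$ in the negative root vectors normalizes $[e_i,f_i]$ to the coroot $h_i$, which
acts on $e_i$ by 2. -/
theorem lie_e₁_f₁ : ⁅rootVec 0 1 1, rootVec 0 (-1 / 4) (1 / 4)⁆ = torusVec (-2) 1 := by
  simp only [rootVec, torusVec, Fin.isValue, Fin.coe_ofNat_eq_mod, Nat.reduceMod, Nat.reduceMul,
    Nat.reduceAdd, Fin.zero_eta, Fin.mk_one, Fin.reduceFinMk]
  rw [lie_derC_derC]
  refine derC_congr ?_ ?_ <;> ext i <;> fin_cases i <;>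
    simp only [Fin.zero_eta, Fin.mk_one, Fin.reduceFinMk, Fin.isValue, Fin.reduceEq, Pi.sub_apply,
      Pi.add_apply, Pi.neg_apply, Pi.smul_apply, Pi.zero_apply, nsmul_eq_mul, derBracket,
      Pi.single_apply, if_true, if_false, mul_zero, zero_mul, sub_zero, zero_sub, add_zero,
      zero_add, neg_zero, mul_one, one_mul] <;>
    norm_num [Pi.single_apply] <;>
    decide

theorem lie_e₂_f₂ : ⁅rootVec 1 1 1, rootVec 1 (-1 / 4) (1 / 4)⁆ = torusVec 1 (-1) := by
  simp only [rootVec, torusVec, Fin.isValue, Fin.coe_ofNat_eq_mod, Nat.reduceMod, Nat.reduceMul,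
    Nat.reduceAdd, Fin.zero_eta, Fin.mk_one, Fin.reduceFinMk]
  rw [lie_derC_derC]
  refine derC_congr ?_ ?_ <;> ext i <;> fin_cases i <;>
    simp only [Fin.zero_eta, Fin.mk_one, Fin.reduceFinMk, Fin.isValue, Fin.reduceEq, Pi.sub_apply,
      Pi.add_apply, Pi.neg_apply, Pi.smul_apply, Pi.zero_apply, nsmul_eq_mul, derBracket,
      Pi.single_apply, if_true, if_false, mul_zero, zero_mul, sub_zero, zero_sub, add_zero,
      zero_add, neg_zero, mul_one, one_mul] <;>
    norm_num [Pi.single_apply] <;>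
    decide

theorem lie_e₁_f₂ : ⁅rootVec 0 1 1, rootVec 1 (-1 / 4) (1 / 4)⁆ = 0 := by
  simp only [rootVec, Fin.isValue, Fin.coe_ofNat_eq_mod, Nat.reduceMod, Nat.reduceMul,
    Nat.reduceAdd, Fin.zero_eta, Fin.mk_one, Fin.reduceFinMk]
  rw [lie_derC_derC, ← derC_zero]
  refine derC_congr ?_ ?_ <;> ext i <;> fin_cases i <;>
    simp only [Fin.zero_eta, Fin.mk_one, Fin.reduceFinMk, Fin.isValue, Fin.reduceEq, Pi.sub_apply,
      Pi.add_apply, Pi.neg_apply, Pi.smul_apply, Pi.zero_apply, nsmul_eq_mul, derBracket,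
      Pi.single_apply, if_true, if_false, mul_zero, zero_mul, sub_zero, zero_sub, add_zero,
      zero_add, neg_zero, mul_one, one_mul] <;>
    norm_num [Pi.single_apply] <;>
    decide

theorem lie_e₂_f₁ : ⁅rootVec 1 1 1, rootVec 0 (-1 / 4) (1 / 4)⁆ = 0 := by
  simp only [rootVec, Fin.isValue, Fin.coe_ofNat_eq_mod, Nat.reduceMod, Nat.reduceMul,
    Nat.reduceAdd, Fin.zero_eta, Fin.mk_one, Fin.reduceFinMk]
  rw [lie_derC_derC, ← derC_zero]
  refine derC_congr ?_ ?_ <;> ext i <;> fin_cases i <;>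
    simp only [Fin.zero_eta, Fin.mk_one, Fin.reduceFinMk, Fin.isValue, Fin.reduceEq, Pi.sub_apply,
      Pi.add_apply, Pi.neg_apply, Pi.smul_apply, Pi.zero_apply, nsmul_eq_mul, derBracket,
      Pi.single_apply, if_true, if_false, mul_zero, zero_mul, sub_zero, zero_sub, add_zero,
      zero_add, neg_zero, mul_one, one_mul] <;>
    norm_num [Pi.single_apply] <;>
    decide

theorem lie_h₁_e₁ : ⁅torusVec (-2) 1, rootVec 0 1 1⁆ = 2 • rootVec 0 1 1 := by
  simp only [rootVec, torusVec, Fin.isValue, Fin.coe_ofNat_eq_mod, Nat.reduceMod, Nat.reduceMul,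
    Nat.reduceAdd, Fin.zero_eta, Fin.mk_one, Fin.reduceFinMk]
  rw [lie_derC_derC, nsmul_derC]
  refine derC_congr ?_ ?_ <;> ext i <;> fin_cases i <;>
    simp only [Fin.zero_eta, Fin.mk_one, Fin.reduceFinMk, Fin.isValue, Fin.reduceEq, Pi.sub_apply,
      Pi.add_apply, Pi.neg_apply, Pi.smul_apply, Pi.zero_apply, nsmul_eq_mul, derBracket,
      Pi.single_apply, if_true, if_false, mul_zero, zero_mul, sub_zero, zero_sub, add_zero,
      zero_add, neg_zero, mul_one, one_mul] <;>
    norm_num [Pi.single_apply] <;>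
    decide

theorem lie_h₁_e₂ : ⁅torusVec (-2) 1, rootVec 1 1 1⁆ = -(3 • rootVec 1 1 1) := by
  simp only [rootVec, torusVec, Fin.isValue, Fin.coe_ofNat_eq_mod, Nat.reduceMod, Nat.reduceMul,
    Nat.reduceAdd, Fin.zero_eta, Fin.mk_one, Fin.reduceFinMk]
  rw [lie_derC_derC, nsmul_derC, neg_derC]
  refine derC_congr ?_ ?_ <;> ext i <;> fin_cases i <;>
    simp only [Fin.zero_eta, Fin.mk_one, Fin.reduceFinMk, Fin.isValue, Fin.reduceEq, Pi.sub_apply,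
      Pi.add_apply, Pi.neg_apply, Pi.smul_apply, Pi.zero_apply, nsmul_eq_mul, derBracket,
      Pi.single_apply, if_true, if_false, mul_zero, zero_mul, sub_zero, zero_sub, add_zero,
      zero_add, neg_zero, mul_one, one_mul] <;>
    norm_num [Pi.single_apply] <;>
    decide

theorem lie_h₂_e₁ : ⁅torusVec 1 (-1), rootVec 0 1 1⁆ = -rootVec 0 1 1 := by
  simp only [rootVec, torusVec, Fin.isValue, Fin.coe_ofNat_eq_mod, Nat.reduceMod, Nat.reduceMul,
    Nat.reduceAdd, Fin.zero_eta, Fin.mk_one, Fin.reduceFinMk]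
  rw [lie_derC_derC, neg_derC]
  refine derC_congr ?_ ?_ <;> ext i <;> fin_cases i <;>
    simp only [Fin.zero_eta, Fin.mk_one, Fin.reduceFinMk, Fin.isValue, Fin.reduceEq, Pi.sub_apply,
      Pi.add_apply, Pi.neg_apply, Pi.smul_apply, Pi.zero_apply, nsmul_eq_mul, derBracket,
      Pi.single_apply, if_true, if_false, mul_zero, zero_mul, sub_zero, zero_sub, add_zero,
      zero_add, neg_zero, mul_one, one_mul] <;>
    norm_num [Pi.single_apply] <;>
    decide

theorem lie_h₂_e₂ : ⁅torusVec 1 (-1), rootVec 1 1 1⁆ = 2 • rootVec 1 1 1 := by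
  simp only [rootVec, torusVec, Fin.isValue, Fin.coe_ofNat_eq_mod, Nat.reduceMod, Nat.reduceMul,
    Nat.reduceAdd, Fin.zero_eta, Fin.mk_one, Fin.reduceFinMk]
  rw [lie_derC_derC, nsmul_derC]
  refine derC_congr ?_ ?_ <;> ext i <;> fin_cases i <;>
    simp only [Fin.zero_eta, Fin.mk_one, Fin.reduceFinMk, Fin.isValue, Fin.reduceEq, Pi.sub_apply,
      Pi.add_apply, Pi.neg_apply, Pi.smul_apply, Pi.zero_apply, nsmul_eq_mul, derBracket,
      Pi.single_apply, if_true, if_false, mul_zero, zero_mul, sub_zero, zero_sub, add_zero,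
      zero_add, neg_zero, mul_one, one_mul] <;>
    norm_num [Pi.single_apply] <;>
    decide

theorem lie_h₁_f₁ :
    ⁅torusVec (-2) 1, rootVec 0 (-1 / 4) (1 / 4)⁆ = -(2 • rootVec 0 (-1 / 4) (1 / 4)) := by
  simp only [rootVec, torusVec, Fin.isValue, Fin.coe_ofNat_eq_mod, Nat.reduceMod, Nat.reduceMul,
    Nat.reduceAdd, Fin.zero_eta, Fin.mk_one, Fin.reduceFinMk]
  rw [lie_derC_derC, nsmul_derC, neg_derC]
  refine derC_congr ?_ ?_ <;> ext i <;> fin_cases i <;>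
    simp only [Fin.zero_eta, Fin.mk_one, Fin.reduceFinMk, Fin.isValue, Fin.reduceEq, Pi.sub_apply,
      Pi.add_apply, Pi.neg_apply, Pi.smul_apply, Pi.zero_apply, nsmul_eq_mul, derBracket,
      Pi.single_apply, if_true, if_false, mul_zero, zero_mul, sub_zero, zero_sub, add_zero,
      zero_add, neg_zero, mul_one, one_mul] <;>
    norm_num [Pi.single_apply] <;>
    decide

theorem lie_h₁_f₂ :
    ⁅torusVec (-2) 1, rootVec 1 (-1 / 4) (1 / 4)⁆ = 3 • rootVec 1 (-1 / 4) (1 / 4) := by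
  simp only [rootVec, torusVec, Fin.isValue, Fin.coe_ofNat_eq_mod, Nat.reduceMod, Nat.reduceMul,
    Nat.reduceAdd, Fin.zero_eta, Fin.mk_one, Fin.reduceFinMk]
  rw [lie_derC_derC, nsmul_derC]
  refine derC_congr ?_ ?_ <;> ext i <;> fin_cases i <;>
    simp only [Fin.zero_eta, Fin.mk_one, Fin.reduceFinMk, Fin.isValue, Fin.reduceEq, Pi.sub_apply,
      Pi.add_apply, Pi.neg_apply, Pi.smul_apply, Pi.zero_apply, nsmul_eq_mul, derBracket,
      Pi.single_apply, if_true, if_false, mul_zero, zero_mul, sub_zero, zero_sub, add_zero,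
      zero_add, neg_zero, mul_one, one_mul] <;>
    norm_num [Pi.single_apply] <;>
    decide

theorem lie_h₂_f₁ : ⁅torusVec 1 (-1), rootVec 0 (-1 / 4) (1 / 4)⁆ = rootVec 0 (-1 / 4) (1 / 4) := by
  simp only [rootVec, torusVec, Fin.isValue, Fin.coe_ofNat_eq_mod, Nat.reduceMod, Nat.reduceMul,
    Nat.reduceAdd, Fin.zero_eta, Fin.mk_one, Fin.reduceFinMk]
  rw [lie_derC_derC]
  refine derC_congr ?_ ?_ <;> ext i <;> fin_cases i <;>
    simp only [Fin.zero_eta, Fin.mk_one, Fin.reduceFinMk, Fin.isValue, Fin.reduceEq, Pi.sub_apply,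
      Pi.add_apply, Pi.neg_apply, Pi.smul_apply, Pi.zero_apply, nsmul_eq_mul, derBracket,
      Pi.single_apply, if_true, if_false, mul_zero, zero_mul, sub_zero, zero_sub, add_zero,
      zero_add, neg_zero, mul_one, one_mul] <;>
    norm_num [Pi.single_apply] <;>
    decide

theorem lie_h₂_f₂ :
    ⁅torusVec 1 (-1), rootVec 1 (-1 / 4) (1 / 4)⁆ = -(2 • rootVec 1 (-1 / 4) (1 / 4)) := by
  simp only [rootVec, torusVec, Fin.isValue, Fin.coe_ofNat_eq_mod, Nat.reduceMod, Nat.reduceMul,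
    Nat.reduceAdd, Fin.zero_eta, Fin.mk_one, Fin.reduceFinMk]
  rw [lie_derC_derC, nsmul_derC, neg_derC]
  refine derC_congr ?_ ?_ <;> ext i <;> fin_cases i <;>
    simp only [Fin.zero_eta, Fin.mk_one, Fin.reduceFinMk, Fin.isValue, Fin.reduceEq, Pi.sub_apply,
      Pi.add_apply, Pi.neg_apply, Pi.smul_apply, Pi.zero_apply, nsmul_eq_mul, derBracket,
      Pi.single_apply, if_true, if_false, mul_zero, zero_mul, sub_zero, zero_sub, add_zero,
      zero_add, neg_zero, mul_one, one_mul] <;>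
    norm_num [Pi.single_apply] <;>
    decide

/-- The weight $4\alpha+\beta$ is not a root. This is the last step of the long Serre relation. -/
theorem lie_e₁_e₅ : ⁅rootVec 0 1 1, rootVec 4 48 48⁆ = 0 := by
  simp only [rootVec, Fin.isValue, Fin.coe_ofNat_eq_mod, Nat.reduceMod, Nat.reduceMul,
    Nat.reduceAdd, Fin.zero_eta, Fin.mk_one, Fin.reduceFinMk]
  rw [lie_derC_derC, ← derC_zero]
  refine derC_congr ?_ ?_ <;> ext i <;> fin_cases i <;>
    simp only [Fin.zero_eta, Fin.mk_one, Fin.reduceFinMk, Fin.isValue, Fin.reduceEq, Pi.sub_apply,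
      Pi.add_apply, Pi.neg_apply, Pi.smul_apply, Pi.zero_apply, nsmul_eq_mul, derBracket,
      Pi.single_apply, if_true, if_false, mul_zero, zero_mul, sub_zero, zero_sub, add_zero,
      zero_add, neg_zero, mul_one, one_mul] <;>
    norm_num [Pi.single_apply] <;>
    decide

theorem lie_e₂_e₃ : ⁅rootVec 1 1 1, rootVec 2 (-2) (-2)⁆ = 0 := by
  simp only [rootVec, Fin.isValue, Fin.coe_ofNat_eq_mod, Nat.reduceMod, Nat.reduceMul,
    Nat.reduceAdd, Fin.zero_eta, Fin.mk_one, Fin.reduceFinMk]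
  rw [lie_derC_derC, ← derC_zero]
  refine derC_congr ?_ ?_ <;> ext i <;> fin_cases i <;>
    simp only [Fin.zero_eta, Fin.mk_one, Fin.reduceFinMk, Fin.isValue, Fin.reduceEq, Pi.sub_apply,
      Pi.add_apply, Pi.neg_apply, Pi.smul_apply, Pi.zero_apply, nsmul_eq_mul, derBracket,
      Pi.single_apply, if_true, if_false, mul_zero, zero_mul, sub_zero, zero_sub, add_zero,
      zero_add, neg_zero, mul_one, one_mul] <;>
    norm_num [Pi.single_apply] <;>
    decide

theorem lie_f₁_f₅ : ⁅rootVec 0 (-1 / 4) (1 / 4), rootVec 4 (3 / 16) (-3 / 16)⁆ = 0 := by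
  simp only [rootVec, Fin.isValue, Fin.coe_ofNat_eq_mod, Nat.reduceMod, Nat.reduceMul,
    Nat.reduceAdd, Fin.zero_eta, Fin.mk_one, Fin.reduceFinMk]
  rw [lie_derC_derC, ← derC_zero]
  refine derC_congr ?_ ?_ <;> ext i <;> fin_cases i <;>
    simp only [Fin.zero_eta, Fin.mk_one, Fin.reduceFinMk, Fin.isValue, Fin.reduceEq, Pi.sub_apply,
      Pi.add_apply, Pi.neg_apply, Pi.smul_apply, Pi.zero_apply, nsmul_eq_mul, derBracket,
      Pi.single_apply, if_true, if_false, mul_zero, zero_mul, sub_zero, zero_sub, add_zero,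
      zero_add, neg_zero, mul_one, one_mul] <;>
    norm_num [Pi.single_apply] <;>
    decide

theorem lie_f₂_f₃ : ⁅rootVec 1 (-1 / 4) (1 / 4), rootVec 2 (-1 / 8) (1 / 8)⁆ = 0 := by
  simp only [rootVec, Fin.isValue, Fin.coe_ofNat_eq_mod, Nat.reduceMod, Nat.reduceMul,
    Nat.reduceAdd, Fin.zero_eta, Fin.mk_one, Fin.reduceFinMk]
  rw [lie_derC_derC, ← derC_zero]
  refine derC_congr ?_ ?_ <;> ext i <;> fin_cases i <;>
    simp only [Fin.zero_eta, Fin.mk_one, Fin.reduceFinMk, Fin.isValue, Fin.reduceEq, Pi.sub_apply,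
      Pi.add_apply, Pi.neg_apply, Pi.smul_apply, Pi.zero_apply, nsmul_eq_mul, derBracket,
      Pi.single_apply, if_true, if_false, mul_zero, zero_mul, sub_zero, zero_sub, add_zero,
      zero_add, neg_zero, mul_one, one_mul] <;>
    norm_num [Pi.single_apply] <;>
    decide

theorem isG2System_rootVec : IsG2System (torusVec (-2) 1) (torusVec 1 (-1)) (rootVec 0 1 1) (rootVec 1 1 1)
    (rootVec 0 (-1 / 4) (1 / 4)) (rootVec 1 (-1 / 4) (1 / 4)) where
  lie_h₁_h₂ := lie_h₁_h₂
  lie_e₁_f₁ := lie_e₁_f₁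
  lie_e₂_f₂ := lie_e₂_f₂
  lie_e₁_f₂ := lie_e₁_f₂
  lie_e₂_f₁ := lie_e₂_f₁
  lie_h₁_e₁ := lie_h₁_e₁
  lie_h₁_e₂ := lie_h₁_e₂
  lie_h₂_e₁ := lie_h₂_e₁
  lie_h₂_e₂ := lie_h₂_e₂
  lie_h₁_f₁ := lie_h₁_f₁
  lie_h₁_f₂ := lie_h₁_f₂
  lie_h₂_f₁ := lie_h₂_f₁
  lie_h₂_f₂ := lie_h₂_f₂
  ad_e₁ := by
    rw [lie_e₁_e₂, lie_e₁_e₃, lie_e₁_e₄]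
    exact lie_e₁_e₅
  ad_e₂ := by
    rw [← lie_skew (rootVec 1 1 1) (rootVec 0 1 1), lie_e₁_e₂, lie_neg, neg_eq_zero]
    exact lie_e₂_e₃
  ad_f₁ := by
    rw [lie_f₁_f₂, lie_f₁_f₃, lie_f₁_f₄]
    exact lie_f₁_f₅
  ad_f₂ := by
    rw [← lie_skew (rootVec 1 (-1 / 4) (1 / 4)) (rootVec 0 (-1 / 4) (1 / 4)), lie_f₁_f₂, lie_neg,
      neg_eq_zero]
    exact lie_f₂_f₃

/-! ### The isomorphism with the algebra of type $G_2$. -/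

theorem eq_top_of_derOf_single_mem (K : Submodule ℂ (ℂ ⊗[ℝ] Der))
    (hK : ∀ k, (1 : ℂ) ⊗ₜ[ℝ] derOf (Pi.single k 1) ∈ K) : K = ⊤ := by
  rw [eq_top_iff]
  rintro x -
  induction x using TensorProduct.induction_on with
  | zero => exact zero_mem _
  | add x y hx hy => exact add_mem hx hy
  | tmul z D =>
    obtain ⟨p, rfl⟩ := derOf_surjective D
    have hp : p = ∑ k, p k • Pi.single k (1 : ℝ) := by
      ext i
      simp [Finset.sum_apply, Pi.single_apply]
    rw [hp, map_sum, TensorProduct.tmul_sum]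
    refine sum_mem fun k _ => ?_
    have h : z ⊗ₜ[ℝ] derOf (p k • Pi.single k 1) =
        (z * p k) • ((1 : ℂ) ⊗ₜ[ℝ] derOf (Pi.single k 1)) := by
      rw [TensorProduct.smul_tmul', smul_eq_mul, mul_one, map_smul, ← TensorProduct.smul_tmul,
        Complex.real_smul, mul_comm]
    rw [h]
    exact K.smul_mem _ (hK k)

/-- Opposite root vectors are multiples of $u+\sqrt{-1}\,v$ and $u-\sqrt{-1}\,v$, where $u$, $v$ is
the real basis of the plane. Their rescaled sum and difference recover $u$ and $v$. -/
theorem tmul_mem_of_rootVec_mem {K : Submodule ℂ (ℂ ⊗[ℝ] Der)} {k : Fin 7} {a b : ℝ}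
    (ha : a ≠ 0) (hb : b ≠ 0) (h1 : rootVec k a a ∈ K) (h2 : rootVec k b (-b) ∈ K) :
    (1 : ℂ) ⊗ₜ[ℝ] derOf (Pi.single (Fin.mk (2 * k.1) (by omega)) 1) ∈ K ∧
    (1 : ℂ) ⊗ₜ[ℝ] derOf (Pi.single (Fin.mk (2 * k.1 + 1) (by omega)) 1) ∈ K := by
  have key : ∀ c d : ℝ, rootVec k c d =
      (c : ℂ) • ((1 : ℂ) ⊗ₜ[ℝ] derOf (Pi.single (Fin.mk (2 * k.1) (by omega)) 1)) +
      (d * Complex.I : ℂ) •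
        ((1 : ℂ) ⊗ₜ[ℝ] derOf (Pi.single (Fin.mk (2 * k.1 + 1) (by omega)) 1)) := fun c d => by
    have hs : ∀ (i : Fin 14) (r : ℝ), Pi.single i r = r • Pi.single (M := fun _ => ℝ) i 1 :=
      fun i r => by rw [← Pi.single_smul, smul_eq_mul, mul_one]
    rw [rootVec, derC, hs _ c, hs _ d]
    simp only [TensorProduct.smul_tmul', smul_eq_mul, mul_one, map_smul,
      ← TensorProduct.smul_tmul, Complex.real_smul]
  generalize (1 : ℂ) ⊗ₜ[ℝ] derOf (Pi.single (Fin.mk (2 * k.1) (by omega)) 1) = u at *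
  generalize (1 : ℂ) ⊗ₜ[ℝ] derOf (Pi.single (Fin.mk (2 * k.1 + 1) (by omega)) 1) = v at *
  rw [key] at h1 h2
  have ha' : (a : ℂ) ≠ 0 := Complex.ofReal_ne_zero.2 ha
  have hb' : (b : ℂ) ≠ 0 := Complex.ofReal_ne_zero.2 hb
  have hI := Complex.I_ne_zero
  constructor
  · have h := add_mem (K.smul_mem (1 / (2 * a) : ℂ) h1) (K.smul_mem (1 / (2 * b) : ℂ) h2)
    convert h using 1
    push_cast
    match_scalars <;> field_simp <;> norm_num
  · have h := sub_mem (K.smul_mem (1 / (2 * a * Complex.I) : ℂ) h1)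
      (K.smul_mem (1 / (2 * b * Complex.I) : ℂ) h2)
    convert h using 1
    push_cast
    match_scalars <;> field_simp <;> norm_num

theorem tmul_mem_of_torusVec_mem {K : Submodule ℂ (ℂ ⊗[ℝ] Der)} (h1 : torusVec (-2) 1 ∈ K)
    (h2 : torusVec 1 (-1) ∈ K) : (1 : ℂ) ⊗ₜ[ℝ] derOf (Pi.single 12 1) ∈ K ∧
    (1 : ℂ) ⊗ₜ[ℝ] derOf (Pi.single 13 1) ∈ K := by
  have key : ∀ c d : ℝ, torusVec c d =
      (c * Complex.I : ℂ) • ((1 : ℂ) ⊗ₜ[ℝ] derOf (Pi.single 12 1)) +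
      (d * Complex.I : ℂ) • ((1 : ℂ) ⊗ₜ[ℝ] derOf (Pi.single 13 1)) := fun c d => by
    have hs : ∀ (i : Fin 14) (r : ℝ), Pi.single i r = r • Pi.single (M := fun _ => ℝ) i 1 :=
      fun i r => by rw [← Pi.single_smul, smul_eq_mul, mul_one]
    rw [torusVec, derC, hs _ c, hs _ d]
    simp only [TensorProduct.smul_tmul', smul_eq_mul, mul_one, map_smul, map_add, map_zero,
      TensorProduct.tmul_zero, TensorProduct.tmul_add, zero_add,
      ← TensorProduct.smul_tmul, Complex.real_smul]
  generalize (1 : ℂ) ⊗ₜ[ℝ] derOf (Pi.single 12 1) = u at *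
  generalize (1 : ℂ) ⊗ₜ[ℝ] derOf (Pi.single 13 1) = v at *
  rw [key] at h1 h2
  have hI := Complex.I_sq
  constructor
  · have h := K.smul_mem Complex.I (add_mem h1 h2)
    convert h using 1
    push_cast
    match_scalars <;> first | ring1 | linear_combination hI
  · have h := K.smul_mem Complex.I (add_mem h1 (K.smul_mem 2 h2))
    convert h using 1
    push_cast
    match_scalars <;> first | ring1 | linear_combination hI

theorem nonempty_lieEquiv_g₂ : Nonempty (ℂ ⊗[ℝ] Der ≃ₗ⁅ℂ⁆ LieAlgebra.g₂ ℂ) := by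
  obtain ⟨ψ, hh1, hh2, he1, he2, hf1, hf2⟩ := isG2System_rootVec.exists_hom
  -- The range contains the simple root vectors and is closed under brackets, so it contains all
  -- twelve root vectors.
  have he3 := lie_e₁_e₂ ▸ ψ.range.lie_mem he1 he2
  have he4 := lie_e₁_e₃ ▸ ψ.range.lie_mem he1 he3
  have he5 := lie_e₁_e₄ ▸ ψ.range.lie_mem he1 he4
  have he6 := lie_e₂_e₅ ▸ ψ.range.lie_mem he2 he5
  have hf3 := lie_f₁_f₂ ▸ ψ.range.lie_mem hf1 hf2
  have hf4 := lie_f₁_f₃ ▸ ψ.range.lie_mem hf1 hf3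
  have hf5 := lie_f₁_f₄ ▸ ψ.range.lie_mem hf1 hf4
  have hf6 := lie_f₂_f₅ ▸ ψ.range.lie_mem hf2 hf5
  have hsingle : ∀ k, (1 : ℂ) ⊗ₜ[ℝ] derOf (Pi.single k 1) ∈ ψ.range.toSubmodule := by
    have r0 := tmul_mem_of_rootVec_mem (K := ψ.range.toSubmodule) (k := 0) (a := 1) (b := -1 / 4)
      (by norm_num) (by norm_num) he1 (by convert hf1 using 2; norm_num)
    have r1 := tmul_mem_of_rootVec_mem (K := ψ.range.toSubmodule) (k := 1) (a := 1) (b := -1 / 4)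
      (by norm_num) (by norm_num) he2 (by convert hf2 using 2; norm_num)
    have r2 := tmul_mem_of_rootVec_mem (K := ψ.range.toSubmodule) (k := 2) (a := -2) (b := -1 / 8)
      (by norm_num) (by norm_num) he3 (by convert hf3 using 2; norm_num)
    have r3 := tmul_mem_of_rootVec_mem (K := ψ.range.toSubmodule) (k := 3) (a := -8) (b := 1 / 8)
      (by norm_num) (by norm_num) he4 (by convert hf4 using 2; norm_num)
    have r4 := tmul_mem_of_rootVec_mem (K := ψ.range.toSubmodule) (k := 4) (a := 48) (b := 3 / 16)
      (by norm_num) (by norm_num) he5 (by convert hf5 using 2; norm_num)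
    have r5 := tmul_mem_of_rootVec_mem (K := ψ.range.toSubmodule) (k := 5) (a := -96) (b := 3 / 32)
      (by norm_num) (by norm_num) he6 (by convert hf6 using 2; norm_num)
    have r6 := tmul_mem_of_torusVec_mem (K := ψ.range.toSubmodule) hh1 hh2
    intro k
    fin_cases k
    exacts [r0.1, r0.2, r1.1, r1.2, r2.1, r2.2, r3.1, r3.2, r4.1, r4.2, r5.1, r5.2, r6.1, r6.2]
  have htop := eq_top_of_derOf_single_mem _ hsingle
  have hsurj : Function.Surjective ψ := fun x => by
    have hx : x ∈ ψ.range.toSubmodule := htop ▸ Submodule.mem_top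
    exact hx
  have hdim : Module.finrank ℂ (ℂ ⊗[ℝ] Der) = 14 := by
    rw [Module.finrank_baseChange, finrank_der]
  have hle : Module.finrank ℂ (ℂ ⊗[ℝ] Der) ≤ Module.finrank ℂ (LieAlgebra.g₂ ℂ) :=
    LinearMap.finrank_le_finrank_of_surjective (f := (ψ : LieAlgebra.g₂ ℂ →ₗ[ℂ] ℂ ⊗[ℝ] Der)) hsurj
  -- Surjectivity gives one inequality and the Serre bound of 14 the other, so the surjection is
  -- injective.
  have heq : Module.finrank ℂ (LieAlgebra.g₂ ℂ) = Module.finrank ℂ (ℂ ⊗[ℝ] Der) :=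
    le_antisymm (finrank_g₂_le.trans hdim.ge) hle
  have hinj : Function.Injective (ψ : LieAlgebra.g₂ ℂ →ₗ[ℂ] ℂ ⊗[ℝ] Der) :=
    (LinearMap.injective_iff_surjective_of_finrank_eq_finrank heq).2 hsurj
  exact ⟨(LieEquiv.ofBijective ψ ⟨hinj, hsurj⟩).symm⟩

end Octonion

end

theorem theorem4 :
    -- `Der 𝕆` is a compact real form of the complex simple Lie algebra of type `G₂`
    IsCompactRealForm Octonion.Der (LieAlgebra.g₂ ℂ) ∧
    ∃ (ρ : Octonion.Der →ₗ⁅ℝ⁆ Octonion.soIm) (ι : Octonion.soIm →ₗ⁅ℝ⁆ Octonion.so)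
      (ad : Octonion.Im →ₗ[ℝ] Octonion.soIm) (L R : Octonion.Im →ₗ[ℝ] Octonion.so)
      (c : Octonion.Im →ₗ[ℝ] Octonion.Im →ₗ[ℝ] Octonion.Im)
      (δ : Octonion.Im →ₗ[ℝ] Octonion.Im →ₗ[ℝ] Octonion.Der),
      -- `ρ` restricts a derivation to `Im 𝕆`; `ι` extends by zero on `ℝ 1`;
      -- the composite is the inclusion of sets of linear maps on `𝕆`
      (∀ (D : Octonion.Der) (x : Octonion.Im), ((ρ D).1 x : Octonion) = D.1 x) ∧
      (∀ T : Octonion.soIm, (ι T).1 1 = 0 ∧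
        ∀ x : Octonion.Im, (ι T).1 (x : Octonion) = (T.1 x : Octonion)) ∧
      (∀ D : Octonion.Der, (ι (ρ D)).1 = D.1) ∧
      Function.Injective ρ ∧ Function.Injective ι ∧
      -- `ad a = [a, ·]` on `Im 𝕆`, and `L a`, `R a` are left and right multiplication by `a`
      (∀ a x : Octonion.Im, ((ad a).1 x : Octonion) = (a : Octonion) * x - x * a) ∧
      (∀ (a : Octonion.Im) (x : Octonion), (L a).1 x = a * x) ∧
      (∀ (a : Octonion.Im) (x : Octonion), (R a).1 x = x * a) ∧
      Function.Injective ad ∧ Function.Injective L ∧ Function.Injective R ∧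
      -- the two decompositions into internal direct sums of vector spaces
      IsCompl (LinearMap.range (ρ : Octonion.Der →ₗ[ℝ] Octonion.soIm)) (LinearMap.range ad) ∧
      DirectSum.IsInternal
        ![LinearMap.range ((ι.comp ρ : Octonion.Der →ₗ⁅ℝ⁆ Octonion.so) :
            Octonion.Der →ₗ[ℝ] Octonion.so),
          LinearMap.range L, LinearMap.range R] ∧
      -- the bilinear operations: `c a b = [a, b]` and
      -- `δ a b = D_{a,b}`, where `D_{a,b} x = [[a, b], x] - 3 ((a b) x - a (b x))`
      (∀ a b : Octonion.Im, (c a b : Octonion) = (a : Octonion) * b - b * a) ∧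
      (∀ (a b : Octonion.Im) (x : Octonion), (δ a b).1 x =
        ((c a b : Octonion) * x - x * c a b) - (3 : ℝ) • ((a : Octonion) * b * x - a * (b * x))) ∧
      -- the brackets of `so(Im 𝕆)` on the summands
      (∀ D E : Octonion.Der, ⁅ρ D, ρ E⁆ = ρ ⁅D, E⁆) ∧
      (∀ (D : Octonion.Der) (a : Octonion.Im), ⁅ρ D, ad a⁆ = ad ((ρ D).1 a)) ∧
      (∀ a b : Octonion.Im, ⁅ad a, ad b⁆ = (2 : ℝ) • ρ (δ a b) - ad (c a b)) ∧
      -- the brackets of `so(𝕆)` on the summands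
      (∀ D E : Octonion.Der, ⁅ι (ρ D), ι (ρ E)⁆ = ι (ρ ⁅D, E⁆)) ∧
      (∀ (D : Octonion.Der) (a : Octonion.Im), ⁅ι (ρ D), L a⁆ = L ((ρ D).1 a)) ∧
      (∀ (D : Octonion.Der) (a : Octonion.Im), ⁅ι (ρ D), R a⁆ = R ((ρ D).1 a)) ∧
      (∀ a b : Octonion.Im, ⁅L a, L b⁆ =
        (2 / 3 : ℝ) • ι (ρ (δ a b)) + (1 / 3 : ℝ) • L (c a b) + (2 / 3 : ℝ) • R (c a b)) ∧
      (∀ a b : Octonion.Im, ⁅R a, R b⁆ =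
        (2 / 3 : ℝ) • ι (ρ (δ a b)) - (2 / 3 : ℝ) • L (c a b) - (1 / 3 : ℝ) • R (c a b)) ∧
      (∀ a b : Octonion.Im, ⁅L a, R b⁆ =
        -(1 / 3 : ℝ) • ι (ρ (δ a b)) + (1 / 3 : ℝ) • L (c a b) - (1 / 3 : ℝ) • R (c a b)) :=
  ⟨⟨Octonion.nonempty_lieEquiv_g₂, Octonion.killingForm_der_neg⟩, Octonion.derToSoIm,
    Octonion.soImToSo, Octonion.adIm, Octonion.leftMul, Octonion.rightMul, Octonion.imCommutator,
    Octonion.innerDer, Octonion.coe_derToSoIm_apply,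
    fun T => ⟨Octonion.soImToSo_apply_one T, Octonion.soImToSo_apply_coe T⟩,
    Octonion.coe_soImToSo_derToSoIm, Octonion.derToSoIm_injective, Octonion.soImToSo_injective,
    Octonion.coe_adIm_apply, Octonion.leftMul_apply, Octonion.rightMul_apply,
    Octonion.adIm_injective, Octonion.leftMul_injective, Octonion.rightMul_injective,
    Octonion.isCompl_der_adIm, Octonion.isInternal_der_leftMul_rightMul,
    Octonion.coe_imCommutator, Octonion.innerDer_apply,
    fun D E => (LieHom.map_lie _ D E).symm, Octonion.lie_derToSoIm_adIm, Octonion.lie_adIm_adIm,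
    fun D E => by rw [← LieHom.map_lie, ← LieHom.map_lie], Octonion.lie_derivation_leftMul,
    Octonion.lie_derivation_rightMul, Octonion.lie_leftMul_leftMul,
    Octonion.lie_rightMul_rightMul, Octonion.lie_leftMul_rightMul⟩
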